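/- **Theorem 3.4.** Let $\Bbbk$ be a field and $\mathcal C$ a locally finite braided category over $\Bbbk$: $\mathcal C$ is abelian, $\Bbbk$-linear and braided monoidal with $\Bbbk$-bilinear tensor product, all morphism spaces are finite dimensional and all objects have finite length. Let $A\in\mathcal C$ be a commutative algebra object with multiplication $\mu$, and suppose that $A=\bigoplus_{i\in\mathcal I}U_i$ in $\mathcal C$ with every $U_i$ invertible (dualizable with invertible evaluation and coevaluation). Assume that * $A$ is simple as a left module over itself; * $\{U_i\}$ has no fixed points: no $U_i\not\cong\mathbb 1$ admits a simple object $N$ with $U_i\otimes N\cong N$, and $U_i\cong\mathbb 1$ holds for at most one index $i$; * $\mathbb 1$ is a direct summand of $A$. Let $\mathrm{Rep}\,A$ be the category of left $A$-modules in $\mathcal C$ and $\mathcal F=\mathcal F_A:\mathcal C\to\mathrm{Rep}\,A$ the induction functor $M\mapsto(A\otimes M,\mu\otimes\mathrm{Id}_M)$, $f\mapsto\mathrm{Id}_A\otimes f$. For an object $X$, the *Loewy length* is the least length of a strictly increasing series of subobjects from $0$ to $X$ with semisimple successive quotients. The *socle filtration* is $0=\mathrm{soc}_0(X)\subset\cdots\subset\mathrm{soc}_n(X)=X$,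 where $\mathrm{soc}_k(X)/\mathrm{soc}_{k-1}(X)$ is the largest semisimple subobject of $X/\mathrm{soc}_{k-1}(X)$. The *radical filtration* is $X=\mathrm{rad}_0(X)\supset\cdots\supset\mathrm{rad}_n(X)=0$, where $\mathrm{rad}_k(X)$ is the smallest subobject of $\mathrm{rad}_{k-1}(X)$ with semisimple quotient. The *Loewy diagram* of such a filtration, written increasingly as $0=M_0\subset\cdots\subset M_n=X$, has as its $k$-th layer the simple factors, with multiplicity, of $M_k/M_{k-1}$; it has an arrow from $Y$ in layer $k$ to $Y'$ in layer $k-1$ if there is a non-split short exact sequence $0\to Y'\to E\to Y\to0$ with $E$ a subquotient of $M_k/M_{k-2}$. Then for every $X\in\mathcal C$: 1. $X$ has a socle and a radical filtration; the length of each is the Loewy length $n$ of $X$, and this is also the Loewy length of $\mathcal F(X)$. The object $\mathcal F(X)$ has a socle and a radical filtration, both of length $n$, and for $0\le k\le n$ there are isomorphisms $\mathcal F(\mathrm{soc}_k(X))\cong\mathrm{soc}_k(\mathcal F(X))$ and $\mathcal F(\mathrm{rad}_k(X))\cong\mathrm{rad}_k(\mathcal F(X))$ compatible with the maps to $\mathcal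 F(X)$. 2. $\mathcal F$ preserves the Loewy diagrams of both filtrations: if the simple factors of layer $k$ for $X$ are $S_1,\dots,S_m$, then those of layer $k$ for $\mathcal F(X)$ are $\mathcal F(S_1),\dots,\mathcal F(S_m)$, which are simple; and if there is an arrow from $Y$ in layer $k$ to $Y'$ in layer $k-1$ in the diagram of $X$, then there is an arrow from $\mathcal F(Y)$ in layer $k$ to $\mathcal F(Y')$ in layer $k-1$ in the diagram of $\mathcal F(X)$. -/

import Mathlib

open CategoryTheory CategoryTheory.Limits CategoryTheory.MonoidalCategory

universe w v u v' u'

/-! ### The category of modules over an algebra object and the induction functor -/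

namespace RepA

open scoped MonObj

variable {C : Type u} [Category.{v} C] [MonoidalCategory C]

section Preadditive

variable [Preadditive C] [MonoidalPreadditive C] (A : C) [MonObj A]

/-- Module morphisms form a subgroup of the morphisms of the ambient category. -/
def homAddSubgroup (M N : Mod C A) : AddSubgroup (M.X ⟶ N.X) where
  carrier := {f | IsModHom A f}
  zero_mem' := ⟨by simp⟩
  add_mem' := by
    rintro f g ⟨hf⟩ ⟨hg⟩
    exact ⟨by
      simp only [selfLeftAction_actionHomRight] at hf hg ⊢
      rw [Preadditive.comp_add, hf, hg, MonoidalPreadditive.whiskerLeft_add,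
        Preadditive.add_comp]⟩
  neg_mem' := by
    rintro f ⟨hf⟩
    exact ⟨by
      simp only [selfLeftAction_actionHomRight] at hf ⊢
      have h : A ◁ (-f) = -(A ◁ f) := (tensorLeft A).map_neg
      rw [Preadditive.comp_neg, hf, h, Preadditive.neg_comp]⟩

/-- A morphism of modules is an element of the subgroup of module morphisms. -/
def homEquiv (M N : Mod C A) : (M ⟶ N) ≃ homAddSubgroup A M N where
  toFun f := ⟨f.hom, f.isModHom⟩
  invFun f := letI : IsModHom A f.1 := f.2; ⟨f.1⟩
  left_inv _ := rfl
  right_inv _ := rfl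

instance (M N : Mod C A) : AddCommGroup (M ⟶ N) := (homEquiv A M N).addCommGroup

/-- Addition of module morphisms is addition of the underlying morphisms. -/
instance : Preadditive (Mod C A) where
  add_comp P Q R f f' g := by
    apply Mod.hom_ext
    exact Preadditive.add_comp _ _ _ f.hom f'.hom g.hom
  comp_add P Q R f g g' := by
    apply Mod.hom_ext
    exact Preadditive.comp_add _ _ _ f.hom g.hom g'.hom

end Preadditive

variable (A : C) [MonObj A]

/-- The left `A`-module `A ⊗ M`, on which `A` acts through multiplication on the left factor. -/
@[reducible]
def freeModObj (M : C) : ModObj A (A ⊗ M) where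
  smul := (α_ A A M).inv ≫ μ[A] ▷ M
  one_smul := by
    simp only [selfLeftAction_actionHomLeft]
    rw [associator_inv_naturality_left_assoc, ← comp_whiskerRight, MonObj.one_mul]
    simp
  mul_smul := by
    change μ[A] ▷ (A ⊗ M) ≫ (α_ A A M).inv ≫ μ[A] ▷ M =
      (α_ A A (A ⊗ M)).hom ≫ A ◁ ((α_ A A M).inv ≫ μ[A] ▷ M) ≫ (α_ A A M).inv ≫ μ[A] ▷ M
    rw [associator_inv_naturality_left_assoc, ← comp_whiskerRight, MonObj.mul_assoc]
    simp only [comp_whiskerRight, whiskerLeft_comp, Category.assoc,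
      associator_inv_naturality_middle_assoc]
    monoidal

/-- The induction functor `M ↦ (A ⊗ M, μ ⊗ Id)`, `f ↦ Id ⊗ f`. -/
def induction : C ⥤ Mod C A where
  obj M := letI := freeModObj A M; ⟨A ⊗ M⟩
  map {M N} f :=
    letI := freeModObj A M
    letI := freeModObj A N
    Mod.Hom.mk'' (A := A) (A ◁ f) (by
      change ((α_ A A M).inv ≫ μ[A] ▷ M) ≫ A ◁ f = A ◁ A ◁ f ≫ (α_ A A N).inv ≫ μ[A] ▷ N
      simp [← whisker_exchange])
  map_id M := by apply Mod.hom_ext; exact whiskerLeft_id A M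
  map_comp f g := by apply Mod.hom_ext; exact whiskerLeft_comp A f g

end RepA

/-! ### Socle and radical filtrations, Loewy length and Loewy diagrams -/

namespace Loewy

variable {D : Type u} [Category.{v} D] [Preadditive D]

/-- `X` is a direct sum (coproduct) of the family `S`. -/
def IsDirectSum {J : Type w} (X : D) (S : J → D) : Prop :=
  ∃ ι : ∀ j, S j ⟶ X, Nonempty (IsColimit (Cofan.mk X ι))

/-- A semisimple object (of finite length): a finite direct sum of simple objects. -/
def IsSemisimple (X : D) : Prop :=
  ∃ (m : ℕ) (S : Fin m → D), (∀ i, Simple (S i)) ∧ IsDirectSum X S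

/-- `Z` is (isomorphic to) the quotient `Y / X` for the monomorphism `f : X ⟶ Y`. -/
def IsQuotient {X Y : D} (f : X ⟶ Y) (Z : D) : Prop :=
  ∃ (g : Y ⟶ Z) (h : f ≫ g = 0), (ShortComplex.mk f g h).ShortExact

/-- `Z` is (isomorphic to) the quotient `Q / P` of two subobjects `P ≤ Q` of `X`. -/
def IsSubobjectQuotient {X : D} (P Q : Subobject X) (Z : D) : Prop :=
  ∃ h : P ≤ Q, IsQuotient (P.ofLE Q h) Z

/-- `P` is the socle of `X`: the largest semisimple subobject. -/
def IsSocle {X : D} (P : Subobject X) : Prop :=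
  IsGreatest {Q : Subobject X | IsSemisimple (Q : D)} P

/-- `P` is the radical of `X`: the smallest subobject with semisimple quotient. -/
def IsRadical {X : D} (P : Subobject X) : Prop :=
  IsLeast {Q : Subobject X | ∃ Z : D, IsQuotient Q.arrow Z ∧ IsSemisimple Z} P

/-- A strictly increasing series `0 = M 0 ⊂ M 1 ⊂ ⋯ ⊂ M n = X` of length `n`
(the values of `M` beyond `n` are irrelevant). -/
structure IsSeries {X : D} (n : ℕ) (M : ℕ → Subobject X) : Prop where
  zero : IsZero (M 0 : D)
  top : M n = ⊤
  strict : ∀ k < n, M k < M (k + 1)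

/-- A series all of whose successive quotients are semisimple. -/
structure IsSemisimpleSeries {X : D} (n : ℕ) (M : ℕ → Subobject X) : Prop
    extends IsSeries n M where
  semisimple : ∀ k < n, ∃ Z : D, IsSubobjectQuotient (M k) (M (k + 1)) Z ∧ IsSemisimple Z

/-- `n` is the Loewy length of `X`: the minimal length of a series with semisimple successive
quotients. -/
def IsLoewyLength (X : D) (n : ℕ) : Prop :=
  IsLeast {m | ∃ M : ℕ → Subobject X, IsSemisimpleSeries m M} n

/-- The socle filtration `0 = M 0 ⊂ M 1 ⊂ ⋯ ⊂ M n = X`: `M (k + 1)` is the preimage in `X` of the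
socle of `X / M k`, so that `M (k + 1) / M k = Soc (X / M k)`. -/
structure IsSocleFiltration {X : D} (n : ℕ) (M : ℕ → Subobject X) : Prop
    extends IsSeries n M where
  step : ∀ k < n, ∃ (Z : D) (g : X ⟶ Z) (h : (M k).arrow ≫ g = 0),
    (ShortComplex.mk (M k).arrow g h).ShortExact ∧
    ∃ P : Subobject Z, IsSocle P ∧
      ∃ t : (M (k + 1) : D) ⟶ (P : D), IsPullback t (M (k + 1)).arrow P.arrow g

/-- The radical filtration `0 = R n ⊂ ⋯ ⊂ R 1 ⊂ R 0 = X`: `R (k + 1) = Rad (R k)`. -/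
structure IsRadicalFiltration {X : D} (n : ℕ) (R : ℕ → Subobject X) : Prop where
  top : R 0 = ⊤
  zero : IsZero (R n : D)
  strict : ∀ k < n, R (k + 1) < R k
  step : ∀ k < n, ∃ P : Subobject (R k : D), IsRadical P ∧
    R (k + 1) = Subobject.mk (P.arrow ≫ (R k).arrow)

/-- The family `S` is the family of simple factors, with multiplicity, of layer `k + 1`, that is of
`M (k + 1) / M k`, in the Loewy diagram of the filtration `M`. -/
def IsLayer {X : D} (M : ℕ → Subobject X) (k : ℕ) {m : ℕ} (S : Fin m → D) : Prop :=
  (∀ i, Simple (S i)) ∧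
    ∃ Z : D, IsSubobjectQuotient (M k) (M (k + 1)) Z ∧ IsDirectSum Z S

/-- `Y` is one of the simple factors of layer `k + 1` of the Loewy diagram of `M`. -/
def InLayer {X : D} (M : ℕ → Subobject X) (k : ℕ) (Y : D) : Prop :=
  ∃ (m : ℕ) (S : Fin m → D), IsLayer M k S ∧ ∃ i, Nonempty (Y ≅ S i)

/-- `E` is a subquotient of `W`. -/
def IsSubquotient (E W : D) : Prop :=
  ∃ (P : D) (i : P ⟶ W) (q : P ⟶ E), Mono i ∧ Epi q

/-- There is a non-split short exact sequence `0 ⟶ Y' ⟶ E ⟶ Y ⟶ 0`. -/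
def HasNonsplitSequence (Y' E Y : D) : Prop :=
  ∃ (f : Y' ⟶ E) (g : E ⟶ Y) (h : f ≫ g = 0),
    (ShortComplex.mk f g h).ShortExact ∧ IsEmpty (ShortComplex.mk f g h).Splitting

/-- The Loewy diagram of `M` has an arrow from the simple factor `Y` of layer `k + 2` to the simple
factor `Y'` of layer `k + 1`. -/
def HasArrow {X : D} (M : ℕ → Subobject X) (k : ℕ) (Y Y' : D) : Prop :=
  InLayer M (k + 1) Y ∧ InLayer M k Y' ∧
    ∃ W : D, IsSubobjectQuotient (M k) (M (k + 2)) W ∧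
      ∃ E : D, IsSubquotient E W ∧ HasNonsplitSequence Y' E Y

section Functor

variable {D' : Type u'} [Category.{v'} D'] [Preadditive D'] (F : D ⥤ D')

/-- `F P ≅ N` compatibly with the maps to `F X`, for subobjects `P` of `X` and `N` of `F X`. -/
def MapsTo {X : D} (P : Subobject X) (N : Subobject (F.obj X)) : Prop :=
  ∃ e : F.obj (P : D) ≅ (N : D'), e.hom ≫ N.arrow = F.map P.arrow

/-- `F` preserves the socle filtration of every object: the Loewy lengths of `X` and `F X`
coincide and `F (soc_k X) ≅ soc_k (F X)` for all `k`. -/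
def PreservesSocleFiltrations : Prop :=
  ∀ X : D, (∃ (n : ℕ) (M : ℕ → Subobject X), IsSocleFiltration n M) ∧
    ∀ (n : ℕ) (M : ℕ → Subobject X), IsSocleFiltration n M →
      IsLoewyLength X n ∧ IsLoewyLength (F.obj X) n ∧
      ∃ N : ℕ → Subobject (F.obj X), IsSocleFiltration n N ∧ ∀ k ≤ n, MapsTo F (M k) (N k)

/-- `F` preserves the radical filtration of every object: the Loewy lengths of `X` and `F X`
coincide and `F (rad_k X) ≅ rad_k (F X)` for all `k`. -/
def PreservesRadicalFiltrations : Prop :=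
  ∀ X : D, (∃ (n : ℕ) (R : ℕ → Subobject X), IsRadicalFiltration n R) ∧
    ∀ (n : ℕ) (R : ℕ → Subobject X), IsRadicalFiltration n R →
      IsLoewyLength X n ∧ IsLoewyLength (F.obj X) n ∧
      ∃ N : ℕ → Subobject (F.obj X), IsRadicalFiltration n N ∧ ∀ k ≤ n, MapsTo F (R k) (N k)

/-- `F` maps the Loewy diagram of the filtration `M` of `X` into that of the filtration `N` of
`F X`, both of length `n`: every layer of the second is the image of the corresponding layer of the
first, and every arrow of the first is sent to an arrow of the second. -/
structure PreservesDiagram {X : D} (n : ℕ) (M : ℕ → Subobject X)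
    (N : ℕ → Subobject (F.obj X)) : Prop where
  layers : ∀ k < n, ∀ (m : ℕ) (S : Fin m → D), IsLayer M k S → IsLayer N k (fun i => F.obj (S i))
  arrows : ∀ k, k + 2 ≤ n → ∀ Y Y' : D, HasArrow M k Y Y' → HasArrow N k (F.obj Y) (F.obj Y')

/-- `F` preserves the Loewy diagrams associated to socle filtrations. -/
def PreservesSocleDiagrams : Prop :=
  ∀ (X : D) (n : ℕ) (M : ℕ → Subobject X) (N : ℕ → Subobject (F.obj X)),
    IsSocleFiltration n M → IsSocleFiltration n N → PreservesDiagram F n M N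

/-- `F` preserves the Loewy diagrams associated to radical filtrations; the `k`-th term from the
bottom of the radical filtration `R` of length `n` is `R (n - k)`. -/
def PreservesRadicalDiagrams : Prop :=
  ∀ (X : D) (n : ℕ) (R : ℕ → Subobject X) (N : ℕ → Subobject (F.obj X)),
    IsRadicalFiltration n R → IsRadicalFiltration n N →
      PreservesDiagram F n (fun k => R (n - k)) (fun k => N (n - k))

end Functor

end Loewy

/-! ### Locally finite categories and invertible objects -/

/-- A locally finite category over `k`: all morphism spaces are finite dimensional and all objects
have finite length, that is, are both Artinian and Noetherian. -/
class IsLocallyFinite (k : Type w) [Field k] (C : Type u) [Category.{v} C] [Abelian C]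
    [Linear k C] : Prop where
  finite_hom : ∀ X Y : C, FiniteDimensional k (X ⟶ Y)
  artinian : ∀ X : C, IsArtinianObject X
  noetherian : ∀ X : C, IsNoetherianObject X

section Invertible

variable {C : Type u} [Category.{v} C] [MonoidalCategory C]

/-- An invertible object: it has a dual such that evaluation and coevaluation are isomorphisms. -/
def IsInvertibleObject (U : C) : Prop :=
  ∃ (V : C) (p : ExactPairing U V),
    IsIso (@ExactPairing.evaluation C _ _ U V p) ∧ IsIso (@ExactPairing.coevaluation C _ _ U V p)

/-- The family `U` has no (simple) fixed points: no member other than the monoidal unit fixes a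
simple object. The unit, which fixes everything, is allowed as a member only once. -/
structure NoFixedPoints [HasZeroMorphisms C] {I : Type w} (U : I → C) : Prop where
  unit_of_fixes : ∀ (i : I) (N : C), Simple N → Nonempty (U i ⊗ N ≅ N) → Nonempty (U i ≅ 𝟙_ C)
  unit_unique : ∀ i j : I, Nonempty (U i ≅ 𝟙_ C) → Nonempty (U j ≅ 𝟙_ C) → i = j

end Invertible

/-! Write `F` for induction. The projections of `A` onto its summands are linearly independent in
the finite-dimensional space `A ⟶ A`, so there are finitely many `U i`, and `A ⊗ -` is a finite sum
of the autoequivalences `U i ⊗ -`. Hence `A ⊗ -` is exact, modules form an abelian category with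
kernels and cokernels computed in `C`, and `F` is exact, faithful and left adjoint to the forgetful
functor.

The unit of `A` identifies `𝟙_ C` with exactly one summand. For simple `S` the other summands `U i ⊗
S` of `A ⊗ S` are simple and not isomorphic to `S`, so by adjunction every endomorphism of `F S` is
`F c` with `c : S ⟶ S`; nonzero ones are invertible (`isIso_of_ne_zero`). Simplicity of `A` gives `F
(U i) ≅ F (𝟙_ C)`, hence `F (U i ⊗ S) ≅ F S`. A nonzero submodule of `F S` contains in `C` a copy of
some `U i ⊗ S`, so it receives a nonzero map from `F S`; composed with the inclusion this is an
automorphism, and the submodule is everything (`simple_induction_obj`). By adjunction every simple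
module is some `F S`, which is a finite sum of simple objects in `C`; so semisimple modules stay
semisimple in `C` (`isSemisimple_forget`).

Now `F` preserves socles: a map from a semisimple module to `F X` has components in the `U i ⊗ X`,
and autoequivalences preserve socles. Radicals are dual. Exactness and faithfulness carry whole
filtrations along, and the socle (radical) filtration moves at least as fast as any semisimple
series, so it is unique and computes the Loewy length. Arrows survive because a retraction of the
unit of `A` turns a splitting of `F` of a sequence into a splitting of the sequence. -/

open ZeroObject

namespace Loewy

/-! ### Direct sums and semisimple objects -/

section DirectSum

variable {D : Type u} [Category.{v} D]

lemma IsDirectSum.of_isColimit {J : Type w} {S : J → D} {c : Cofan S} (hc : IsColimit c) :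
    IsDirectSum c.pt S :=
  ⟨c.inj, ⟨IsColimit.ofIsoColimit hc (Cofan.ext (Iso.refl _))⟩⟩

lemma IsDirectSum.of_iso {J : Type w} {S : J → D} {X Y : D} (h : IsDirectSum X S) (e : X ≅ Y) :
    IsDirectSum Y S := by
  obtain ⟨ι, ⟨hι⟩⟩ := h
  exact ⟨fun j => ι j ≫ e.hom, ⟨IsColimit.ofIsoColimit hι (Cofan.ext e)⟩⟩

end DirectSum

section Semisimple

variable {D : Type u} [Category.{v} D] [Abelian D]

/-- Iterated direct sums of simple objects; an inductive form of `IsSemisimple`. -/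
inductive IsIteratedSum : D → Prop
  | zero {X : D} : IsZero X → IsIteratedSum X
  | sum {X Y S : D} : IsIteratedSum X → Simple S → (Y ≅ S ⊞ X) → IsIteratedSum Y

lemma IsSemisimple.of_iso {X Y : D} (h : IsSemisimple X) (e : X ≅ Y) : IsSemisimple Y := by
  obtain ⟨m, S, hS, h⟩ := h
  exact ⟨m, S, hS, h.of_iso e⟩

lemma IsIteratedSum.isSemisimple {X : D} (h : IsIteratedSum X) : IsSemisimple X := by
  induction h with
  | zero h =>
    refine ⟨0, Fin.elim0, fun i => i.elim0, fun i => i.elim0, ⟨?_⟩⟩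
    exact Cofan.IsColimit.mk _ (fun s => 0) (fun s j => j.elim0) (fun s m _ => h.eq_of_src _ _)
  | @sum X Y S _ hS e ih =>
    obtain ⟨m, T, hT, ι, ⟨hι⟩⟩ := ih
    let f : Fin (m + 1) → D := Fin.cons S T
    refine ⟨m + 1, f, ?_, ?_⟩
    · intro i
      refine Fin.cases ?_ ?_ i
      · exact hS
      · exact hT
    · let c₁ : Cofan fun i : Fin m => f i.succ := Cofan.mk X ι
      let c₂ : BinaryCofan (f 0) c₁.pt :=
        BinaryCofan.mk (biprod.inl : S ⟶ S ⊞ X) (biprod.inr : X ⟶ S ⊞ X)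
      have h₂ : IsColimit c₂ := BinaryBiproduct.isColimit S X
      have := extendCofanIsColimit f (c₁ := c₁) (c₂ := c₂) hι h₂
      exact (IsDirectSum.of_isColimit this).of_iso e.symm

lemma IsSemisimple.isIteratedSum {X : D} (h : IsSemisimple X) : IsIteratedSum X := by
  obtain ⟨m, S, hS, ι, ⟨hι⟩⟩ := h
  induction m generalizing X with
  | zero =>
    refine .zero ((IsZero.iff_id_eq_zero X).2 ?_)
    exact Cofan.IsColimit.hom_ext hι _ _ (fun i => i.elim0)
  | succ m ih =>
    let c₁ : Cofan fun i : Fin m => S i.succ := Cofan.mk _ (Sigma.ι fun i : Fin m => S i.succ)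
    have h₁ : IsColimit c₁ := coproductIsCoproduct _
    let c₂ : BinaryCofan (S 0) c₁.pt :=
      BinaryCofan.mk (biprod.inl : S 0 ⟶ S 0 ⊞ c₁.pt) (biprod.inr : c₁.pt ⟶ S 0 ⊞ c₁.pt)
    have h₂ : IsColimit c₂ := BinaryBiproduct.isColimit _ _
    have h₃ := extendCofanIsColimit S h₁ h₂
    exact .sum (ih (fun i : Fin m => S i.succ) (fun i => hS _) (fun i => c₁.inj i) h₁) (hS 0)
      (hι.coconePointUniqueUpToIso h₃)

lemma isSemisimple_iff {X : D} : IsSemisimple X ↔ IsIteratedSum X :=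
  ⟨fun h => h.isIteratedSum, fun h => h.isSemisimple⟩

lemma IsSemisimple.of_isZero {X : D} (h : IsZero X) : IsSemisimple X :=
  (IsIteratedSum.zero h).isSemisimple

lemma IsSemisimple.of_simple (X : D) [Simple X] : IsSemisimple X :=
  (IsIteratedSum.sum (IsIteratedSum.zero (isZero_zero D)) ‹Simple X›
    (isoBiprodZero (isZero_zero D))).isSemisimple

lemma IsSemisimple.biprod {X Y : D} (hX : IsSemisimple X) (hY : IsSemisimple Y) :
    IsSemisimple (X ⊞ Y) := by
  rw [isSemisimple_iff] at *
  induction hX with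
  | zero h =>
    exact (IsSemisimple.of_iso hY.isSemisimple (isoZeroBiprod h)).isIteratedSum
  | @sum X Z S _ hS e ih =>
    exact .sum ih hS (biprod.mapIso e (Iso.refl Y) ≪≫ biprod.associator S X Y)

/-- Induction on the number of summands. Write the map as `(a, b)` on `S ⊞ X` and let `m` be the
image of `b`. Since `S` is simple, `a` modulo `m` is either zero, and then `m` is all of `Z`, or
invertible, and then `Z` is the direct sum of `S` and `m`. The section comes from the one for `X`
onto the image. -/
lemma IsIteratedSum.split_epi {X : D} (hX : IsIteratedSum X) :
    ∀ {Z : D} (f : X ⟶ Z) [Epi f], IsIteratedSum Z ∧ ∃ s : Z ⟶ X, s ≫ f = 𝟙 Z := by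
  induction hX with
  | @zero X h =>
    intro Z f _
    have hZ : IsZero Z := IsZero.of_epi f h
    exact ⟨.zero hZ, 0, hZ.eq_of_src _ _⟩
  | @sum X Y S _ hS e ih =>
    intro Z f _
    have hg : Epi (e.inv ≫ f) := inferInstance
    obtain ⟨g, rfl⟩ : ∃ g : S ⊞ X ⟶ Z, f = e.hom ≫ g := ⟨e.inv ≫ f, by simp⟩
    simp only [Iso.inv_hom_id_assoc] at hg
    obtain ⟨a, b, rfl⟩ : ∃ a b, g = biprod.desc a b :=
      ⟨biprod.inl ≫ g, biprod.inr ≫ g, by ext <;> simp⟩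
    obtain ⟨hI, t, ht⟩ := ih (factorThruImage b)
    have hb : factorThruImage b ≫ image.ι b = b := image.fac b
    set p := factorThruImage b
    set m := image.ι b
    have hepi : Epi (a ≫ cokernel.π m) := by
      have h1 : Epi (biprod.desc a b ≫ cokernel.π m) := inferInstance
      have h2 : biprod.desc a b ≫ cokernel.π m = biprod.fst ≫ a ≫ cokernel.π m := by
        ext
        · simp
        · simp [← hb]
      rw [h2] at h1
      exact epi_of_epi (biprod.fst : S ⊞ X ⟶ S) (a ≫ cokernel.π m)
    by_cases h0 : a ≫ cokernel.π m = 0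
    · have hm : Epi m := by
        refine Preadditive.epi_of_cokernel_zero ?_
        rw [h0] at hepi
        rw [← Category.comp_id (cokernel.π m), (IsZero.iff_id_eq_zero _).1 (IsZero.of_epi_zero S _),
          comp_zero]
      have : IsIso m := isIso_of_mono_of_epi m
      refine ⟨(IsSemisimple.of_iso hI.isSemisimple (asIso m)).isIteratedSum,
        inv m ≫ t ≫ biprod.inr ≫ e.inv, ?_⟩
      have : t ≫ b = m := by simpa [hb] using ht =≫ m
      simp [this]
    · have hiso : IsIso (a ≫ cokernel.π m) := isIso_of_epi_of_nonzero h0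
      have hmono : Mono (biprod.desc a m) := by
        refine Preadditive.mono_of_cancel_zero _ fun {T} x hx => ?_
        have hx' : x ≫ biprod.fst ≫ a + x ≫ biprod.snd ≫ m = 0 := by
          rw [← hx, ← Preadditive.comp_add, biprod.desc_eq]
        have h1 : x ≫ biprod.fst = 0 := by
          rw [← cancel_mono (a ≫ cokernel.π m), zero_comp]
          simpa using hx' =≫ cokernel.π m
        have h2 : x ≫ biprod.snd = 0 := by
          rw [← cancel_mono m, zero_comp]
          rw [reassoc_of% h1, zero_comp, zero_add] at hx'
          simpa using hx'
        ext <;> simp [h1, h2]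
      have hfac : biprod.desc a b = biprod.map (𝟙 S) p ≫ biprod.desc a m := by
        ext <;> simp [hb]
      have hepi' : Epi (biprod.desc a m) := by
        rw [hfac] at hg
        exact epi_of_epi (biprod.map (𝟙 S) p) _
      have : IsIso (biprod.desc a m) := isIso_of_mono_of_epi _
      refine ⟨.sum hI hS (asIso (biprod.desc a m)).symm,
        inv (biprod.desc a m) ≫ biprod.map (𝟙 S) t ≫ e.inv, ?_⟩
      have h1 : biprod.map (𝟙 S) t ≫ biprod.map (𝟙 S) p = 𝟙 _ := by
        ext <;> simp [ht]
      rw [hfac]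
      simp [reassoc_of% h1]

lemma IsSemisimple.of_epi {X Z : D} (hX : IsSemisimple X) (f : X ⟶ Z) [Epi f] :
    IsSemisimple Z :=
  (hX.isIteratedSum.split_epi f).1.isSemisimple

/-- The projection to the cokernel splits, so the subobject is also a quotient. -/
lemma IsSemisimple.of_mono {X Z : D} (hX : IsSemisimple X) (f : Z ⟶ X) [Mono f] :
    IsSemisimple Z := by
  obtain ⟨s, hs⟩ := (hX.isIteratedSum.split_epi (cokernel.π f)).2
  let σ := ShortComplex.Splitting.ofExactOfSection _ (ShortComplex.exact_cokernel f) s hs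
    (inferInstanceAs (Mono f))
  have : Epi σ.r := (SplitEpi.mk f σ.f_r).epi
  exact hX.of_epi (σ.r : X ⟶ Z)

/-- An additive functor that sends simple objects to semisimple ones preserves semisimplicity. -/
lemma IsSemisimple.map {D' : Type u'} [Category.{v'} D'] [Abelian D'] (F : D ⥤ D') [F.Additive]
    (hF : ∀ S : D, Simple S → IsSemisimple (F.obj S)) {X : D} (hX : IsSemisimple X) :
    IsSemisimple (F.obj X) := by
  rw [isSemisimple_iff] at hX
  induction hX with
  | zero h => exact .of_isZero (F.map_isZero h)
  | @sum X Y S _ hS e ih =>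
    have := preservesBinaryBiproducts_of_preservesBiproducts F
    exact ((hF S hS).biprod ih).of_iso ((F.mapBiprod S X).symm ≪≫ F.mapIso e.symm)

end Semisimple

/-! ### Socles and radicals: mapping properties and existence -/

section SocleRadical

variable {D : Type u} [Category.{v} D] [Abelian D] {X : D}

/-- The image of a semisimple object is semisimple. This mapping property, unlike the
order-theoretic definition, transports well along functors. -/
lemma IsSocle.factors {P : Subobject X} (hP : IsSocle P) {Q : D} (hQ : IsSemisimple Q)
    (f : Q ⟶ X) : ∃ l : Q ⟶ (P : D), l ≫ P.arrow = f := by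
  have h : imageSubobject f ≤ P := hP.2 (hQ.of_epi (factorThruImageSubobject f))
  exact ⟨factorThruImageSubobject f ≫ Subobject.ofLE _ _ h, by simp⟩

lemma isSocle_of_factors {P : Subobject X} (hP : IsSemisimple (P : D))
    (h : ∀ (Q : D) (f : Q ⟶ X), IsSemisimple Q → ∃ l : Q ⟶ (P : D), l ≫ P.arrow = f) :
    IsSocle P := by
  refine ⟨hP, fun Q hQ => ?_⟩
  obtain ⟨l, hl⟩ := h _ Q.arrow hQ
  exact Subobject.le_of_comm l hl

lemma IsQuotient.of_iso {X Y Z Z' : D} {f : X ⟶ Y} (h : IsQuotient f Z) (e : Z ≅ Z') :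
    IsQuotient f Z' := by
  obtain ⟨g, w, hg⟩ := h
  exact ⟨g ≫ e.hom, by rw [reassoc_of% w, zero_comp],
    ShortComplex.shortExact_of_iso (S₁ := ShortComplex.mk f g w)
      (ShortComplex.isoMk (Iso.refl _) (Iso.refl _) e (by simp) (by simp)) hg⟩

lemma IsQuotient.comp_eq {X X' Y Z : D} {f : X ⟶ Y} (h : IsQuotient f Z) (e : X' ≅ X)
    {f' : X' ⟶ Y} (hf : e.hom ≫ f = f') : IsQuotient f' Z := by
  obtain ⟨g, w, hg⟩ := h
  exact ⟨g, by rw [← hf, Category.assoc, w, comp_zero],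
    ShortComplex.shortExact_of_iso (S₁ := ShortComplex.mk f g w)
      (ShortComplex.isoMk e.symm (Iso.refl _) (Iso.refl _) (by simp [← hf]) (by simp)) hg⟩

lemma IsQuotient.of_kernel {X Y Z : D} {f : X ⟶ Y} [Mono f] (g : Y ⟶ Z) [Epi g] (w : f ≫ g = 0)
    (h : ∀ (T : D) (x : T ⟶ Y), x ≫ g = 0 → ∃ l : T ⟶ X, l ≫ f = x) : IsQuotient f Z := by
  refine ⟨g, w, .mk ?_⟩
  rw [ShortComplex.exact_iff_exact_up_to_refinements]
  intro T x hx
  obtain ⟨l, hl⟩ := h T x hx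
  exact ⟨T, 𝟙 T, inferInstance, l, by simpa using hl.symm⟩

lemma isQuotient_kernelSubobject {X Z : D} (g : X ⟶ Z) :
    IsQuotient (kernelSubobject g).arrow (image g) := by
  refine IsQuotient.of_kernel (factorThruImage g) ?_ ?_
  · rw [← cancel_mono (image.ι g), Category.assoc, image.fac, kernelSubobject_arrow_comp, zero_comp]
  · intro T x hx
    have hx' : x ≫ g = 0 := by rw [← image.fac g, reassoc_of% hx, zero_comp]
    exact ⟨factorThruKernelSubobject g x hx', by simp⟩

/-- The quotient by the kernel of `g` is the image of `g`, which is semisimple as a subobject of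
`Z`. -/
lemma IsRadical.comp_eq_zero {P : Subobject X} (hP : IsRadical P) {Z : D} (hZ : IsSemisimple Z)
    (g : X ⟶ Z) : P.arrow ≫ g = 0 := by
  have h : P ≤ kernelSubobject g :=
    hP.2 ⟨_, isQuotient_kernelSubobject g, hZ.of_mono (image.ι g)⟩
  rw [← Subobject.ofLE_arrow h, Category.assoc, kernelSubobject_arrow_comp, comp_zero]

lemma isRadical_of_comp_eq_zero {P : Subobject X} {Z : D} (hZ : IsSemisimple Z)
    (hP : IsQuotient P.arrow Z)
    (h : ∀ (Z : D) (g : X ⟶ Z), IsSemisimple Z → P.arrow ≫ g = 0) : IsRadical P := by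
  refine ⟨⟨Z, hP, hZ⟩, ?_⟩
  rintro Q ⟨W, ⟨g, w, hg⟩, hW⟩
  have := hg.mono_f
  exact Subobject.le_of_comm (hg.exact.lift P.arrow (h W g hW)) (hg.exact.lift_f _ _)

/-- A maximal semisimple subobject is the largest one, because the sum of two semisimple subobjects
is a quotient of their direct sum. -/
lemma exists_isSocle (X : D) [IsNoetherianObject X] : ∃ P : Subobject X, IsSocle P := by
  obtain ⟨P, hP, hmax⟩ := (wellFounded_gt (α := Subobject X)).has_min
    {Q : Subobject X | IsSemisimple (Q : D)}
    ⟨⊥, IsSemisimple.of_isZero ((isZero_zero D).of_iso Subobject.botCoeIsoZero)⟩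
  refine ⟨P, hP, fun Q hQ => ?_⟩
  let d : (P : D) ⊞ (Q : D) ⟶ X := biprod.desc P.arrow Q.arrow
  have hI : IsSemisimple (imageSubobject d : D) :=
    (hP.biprod hQ).of_epi (factorThruImageSubobject d)
  have h1 : P ≤ imageSubobject d :=
    Subobject.le_of_comm (biprod.inl ≫ factorThruImageSubobject d) (by simp [d])
  have h2 : Q ≤ imageSubobject d :=
    Subobject.le_of_comm (biprod.inr ≫ factorThruImageSubobject d) (by simp [d])
  rcases h1.lt_or_eq with h | h
  · exact absurd h (hmax _ hI)
  · exact h ▸ h2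

/-- A minimal candidate is the least one: the quotient by the intersection of two candidates embeds
in the direct sum of the two semisimple quotients. -/
lemma exists_isRadical (X : D) [IsArtinianObject X] : ∃ P : Subobject X, IsRadical P := by
  have key : ∀ {Z : D} (g : X ⟶ Z), IsSemisimple Z →
      ∃ W : D, IsQuotient (kernelSubobject g).arrow W ∧ IsSemisimple W :=
    fun g hZ => ⟨_, isQuotient_kernelSubobject g, hZ.of_mono (image.ι g)⟩
  obtain ⟨P, hP, hmin⟩ := (wellFounded_lt (α := Subobject X)).has_min
    {Q : Subobject X | ∃ Z : D, IsQuotient Q.arrow Z ∧ IsSemisimple Z}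
    ⟨_, key (0 : X ⟶ (0 : D)) (.of_isZero (isZero_zero D))⟩
  refine ⟨P, hP, fun Q hQ => ?_⟩
  obtain ⟨Z, ⟨g, w, hg⟩, hZ⟩ := hP
  obtain ⟨Z', ⟨g', w', hg'⟩, hZ'⟩ := hQ
  have := hg.mono_f
  have := hg'.mono_f
  let d : X ⟶ Z ⊞ Z' := biprod.lift g g'
  have h0 : (kernelSubobject d).arrow ≫ d = 0 := kernelSubobject_arrow_comp d
  have h1 : (kernelSubobject d).arrow ≫ g = 0 := by
    rw [← biprod.lift_fst g g', ← Category.assoc, h0, zero_comp]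
  have h2 : (kernelSubobject d).arrow ≫ g' = 0 := by
    rw [← biprod.lift_snd g g', ← Category.assoc, h0, zero_comp]
  have h1' : kernelSubobject d ≤ P :=
    Subobject.le_of_comm (hg.exact.lift _ h1) (hg.exact.lift_f _ _)
  have h2' : kernelSubobject d ≤ Q :=
    Subobject.le_of_comm (hg'.exact.lift _ h2) (hg'.exact.lift_f _ _)
  rcases h1'.lt_or_eq with h | h
  · exact absurd h (hmin _ (key d (hZ.biprod hZ')))
  · exact h ▸ h2'

lemma exists_simple_quotient (Y : D) [IsNoetherianObject Y] (hY : ¬ IsZero Y) :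
    ∃ (S : D) (g : Y ⟶ S), Simple S ∧ Epi g := by
  obtain ⟨Q, hQ, hmax⟩ := (wellFounded_gt (α := Subobject Y)).has_min {Q : Subobject Y | Q ≠ ⊤}
    ⟨⊥, fun h => hY ((isZero_zero D).of_iso
      ((asIso (⊤ : Subobject Y).arrow).symm ≪≫ Subobject.isoOfEq _ _ h.symm ≪≫
        Subobject.botCoeIsoZero))⟩
  have hπ : cokernel.π Q.arrow ≠ 0 := by
    intro h
    have : Epi Q.arrow := Preadditive.epi_of_cokernel_zero h
    have : IsIso Q.arrow := isIso_of_mono_of_epi _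
    exact hQ (Subobject.eq_top_of_isIso_arrow Q)
  -- Simplicity is tested on quotients: the kernel of `Y ⟶ cokernel ⟶ W` contains the maximal proper
  -- `Q`, so for nonzero `f` it equals `Q`.
  refine ⟨cokernel Q.arrow, cokernel.π Q.arrow, simple_of_cosimple _ fun {W} f _ => ⟨?_, ?_⟩,
    inferInstance⟩
  · rintro _ rfl
    apply hπ
    rw [← cancel_mono (0 : cokernel Q.arrow ⟶ W)]
    simp
  · intro hf
    suffices Mono f from isIso_of_mono_of_epi f
    have hle : Q ≤ kernelSubobject (cokernel.π Q.arrow ≫ f) :=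
      Subobject.le_of_comm (factorThruKernelSubobject _ Q.arrow (by simp)) (by simp)
    have hne : kernelSubobject (cokernel.π Q.arrow ≫ f) ≠ ⊤ := by
      intro h
      apply hf
      have h1 := kernelSubobject_arrow_comp (cokernel.π Q.arrow ≫ f)
      have : IsIso (kernelSubobject (cokernel.π Q.arrow ≫ f)).arrow := by
        rw [h]; infer_instance
      rw [← cancel_epi (cokernel.π Q.arrow), comp_zero]
      rw [← cancel_epi (kernelSubobject (cokernel.π Q.arrow ≫ f)).arrow, h1, comp_zero]
    have heq : kernelSubobject (cokernel.π Q.arrow ≫ f) ≤ Q := by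
      rcases hle.lt_or_eq with h | h
      · exact absurd h (hmax _ hne)
      · exact h.ge
    refine Preadditive.mono_of_cancel_zero f fun {T} x hx => ?_
    obtain ⟨T', p, _, y, hy⟩ := surjective_up_to_refinements_of_epi (cokernel.π Q.arrow) x
    have hy0 : y ≫ cokernel.π Q.arrow ≫ f = 0 := by rw [← reassoc_of% hy, hx, comp_zero]
    have hy1 : y = factorThruKernelSubobject _ y hy0 ≫ Subobject.ofLE _ _ heq ≫ Q.arrow := by
      simp
    rw [← cancel_epi p, hy, comp_zero, hy1, Category.assoc, Category.assoc, cokernel.condition,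
      comp_zero, comp_zero]

end SocleRadical

/-! ### Socle and radical filtrations, and Loewy length -/

section Series

variable {D : Type u} [Category.{v} D] [Abelian D] {X : D}

lemma le_of_isZero {P : Subobject X} (hP : IsZero (P : D)) (Q : Subobject X) : P ≤ Q :=
  Subobject.le_of_comm 0 (hP.eq_of_src _ _)

/-- The socle filtration rises fastest: if `L k ≤ M k`, the semisimple `L (k + 1) / L k` maps to `X
/ M k`, hence into its socle, whose preimage is `M (k + 1)`. -/
lemma IsSocleFiltration.le {n m : ℕ} {M L : ℕ → Subobject X} (hM : IsSocleFiltration n M)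
    (hL : IsSemisimpleSeries m L) : ∀ k, k ≤ n → k ≤ m → L k ≤ M k := by
  intro k
  induction k with
  | zero => exact fun _ _ => le_of_isZero hL.zero _
  | succ k ih =>
    intro hkn hkm
    have hk := ih (by omega) (by omega)
    obtain ⟨Z, g, hg, hS, P, hP, t, ht⟩ := hM.step k (by omega)
    obtain ⟨W, ⟨hle, w, hw, hW⟩, hWs⟩ := hL.semisimple k (by omega)
    have := hW.epi_g
    have h0 : (L k).ofLE (L (k + 1)) hle ≫ (L (k + 1)).arrow ≫ g = 0 := by
      rw [Subobject.ofLE_arrow_assoc, ← Subobject.ofLE_arrow hk, Category.assoc, hg, comp_zero]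
    obtain ⟨l, hl⟩ := hP.factors hWs (hW.exact.desc ((L (k + 1)).arrow ≫ g) h0)
    refine Subobject.le_of_comm (ht.lift (w ≫ l) (L (k + 1)).arrow ?_) (ht.lift_snd _ _ _)
    rw [Category.assoc, hl]
    exact hW.exact.g_desc _ _

lemma IsSocleFiltration.isSemisimpleSeries {n : ℕ} {M : ℕ → Subobject X}
    (hM : IsSocleFiltration n M) : IsSemisimpleSeries n M := by
  refine ⟨hM.toIsSeries, fun k hk => ?_⟩
  obtain ⟨Z, g, hg, hS, P, hP, t, ht⟩ := hM.step k hk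
  have hle : M k ≤ M (k + 1) := (hM.strict k hk).le
  have : Epi g := hS.epi_g
  have := hS.mono_f
  -- Pulling the quotient map back along the socle gives an epimorphism with kernel `M k`, so the
  -- layer is the socle of `X / M k`.
  have : Epi t := Abelian.epi_fst_of_isLimit _ _ ht.isLimit
  refine ⟨P, ⟨hle, IsQuotient.of_kernel t ?_ ?_⟩, hP.1⟩
  · rw [← cancel_mono P.arrow, Category.assoc, ht.w, Subobject.ofLE_arrow_assoc, hg, zero_comp]
  · intro T x hx
    have h0 : (x ≫ (M (k + 1)).arrow) ≫ g = 0 := by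
      rw [Category.assoc, ← ht.w, reassoc_of% hx, zero_comp]
    refine ⟨hS.exact.lift _ h0, ?_⟩
    rw [← cancel_mono (M (k + 1)).arrow, Category.assoc, Subobject.ofLE_arrow]
    exact hS.exact.lift_f _ _

lemma IsSocleFiltration.isLoewyLength {n : ℕ} {M : ℕ → Subobject X}
    (hM : IsSocleFiltration n M) : IsLoewyLength X n := by
  refine ⟨⟨M, hM.isSemisimpleSeries⟩, ?_⟩
  rintro m ⟨L, hL⟩
  by_contra! h
  have h1 := hM.le hL m h.le le_rfl
  rw [hL.top, top_le_iff] at h1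
  have := hM.strict m h
  rw [h1] at this
  exact not_top_lt this

/-- Uniqueness allows an arbitrary socle filtration of `F X` to be replaced by the image of the one
of `X`. -/
lemma IsSocleFiltration.eq {n : ℕ} {M M' : ℕ → Subobject X}
    (hM : IsSocleFiltration n M) (hM' : IsSocleFiltration n M') {k : ℕ} (hk : k ≤ n) :
    M k = M' k :=
  le_antisymm (hM'.le hM.isSemisimpleSeries k hk hk) (hM.le hM'.isSemisimpleSeries k hk hk)

/-- The radical filtration descends fastest: the radical of `R k` is killed by every map to a
semisimple object, in particular to the layer of `L` just below `L (m - k)`. -/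
lemma IsRadicalFiltration.le {n m : ℕ} {R L : ℕ → Subobject X} (hR : IsRadicalFiltration n R)
    (hL : IsSemisimpleSeries m L) : ∀ k, k ≤ n → k ≤ m → R k ≤ L (m - k) := by
  intro k
  induction k with
  | zero =>
    intro _ _
    rw [Nat.sub_zero, hL.top]
    exact le_top
  | succ k ih =>
    intro hkn hkm
    have hk := ih (by omega) (by omega)
    obtain ⟨j, hj, hj'⟩ : ∃ j, m - (k + 1) = j ∧ m - k = j + 1 := ⟨_, rfl, by omega⟩
    rw [hj'] at hk
    rw [hj]
    obtain ⟨P, hP, hPR⟩ := hR.step k (by omega)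
    obtain ⟨W, ⟨hle, w, hw, hW⟩, hWs⟩ := hL.semisimple j (by omega)
    have := hW.mono_f
    have h0 : (P.arrow ≫ Subobject.ofLE _ _ hk) ≫ w = 0 := by
      rw [Category.assoc]
      exact hP.comp_eq_zero hWs _
    rw [hPR]
    refine Subobject.mk_le_of_comm (hW.exact.lift _ h0) ?_
    have h1 : hW.exact.lift _ h0 ≫ (L j).ofLE _ hle = _ := hW.exact.lift_f _ h0
    rw [← Subobject.ofLE_arrow hle, reassoc_of% h1, Subobject.ofLE_arrow]

lemma IsRadicalFiltration.isSemisimpleSeries {n : ℕ} {R : ℕ → Subobject X}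
    (hR : IsRadicalFiltration n R) : IsSemisimpleSeries n fun k => R (n - k) := by
  refine ⟨⟨by simpa using hR.zero, by simpa using hR.top, fun k hk => ?_⟩, fun k hk => ?_⟩
  · have := hR.strict (n - (k + 1)) (by omega)
    rwa [show n - (k + 1) + 1 = n - k by omega] at this
  · obtain ⟨P, hP, hPR⟩ := hR.step (n - (k + 1)) (by omega)
    have hs := hR.strict (n - (k + 1)) (by omega)
    rw [show n - (k + 1) + 1 = n - k by omega] at hPR hs
    obtain ⟨Z, hZ, hZs⟩ := hP.1
    refine ⟨Z, ⟨hs.le, hZ.comp_eq (Subobject.isoOfEq _ _ hPR ≪≫ Subobject.underlyingIso _) ?_⟩,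
      hZs⟩
    rw [← cancel_mono (R (n - (k + 1))).arrow]
    simp

lemma IsRadicalFiltration.isLoewyLength {n : ℕ} {R : ℕ → Subobject X}
    (hR : IsRadicalFiltration n R) : IsLoewyLength X n := by
  refine ⟨⟨_, hR.isSemisimpleSeries⟩, ?_⟩
  rintro m ⟨L, hL⟩
  by_contra! h
  have h1 := hR.le hL m h.le le_rfl
  rw [Nat.sub_self] at h1
  exact (hR.strict m h).not_ge (h1.trans (le_of_isZero hL.zero _))

lemma IsRadicalFiltration.eq {n : ℕ} {R R' : ℕ → Subobject X}
    (hR : IsRadicalFiltration n R) (hR' : IsRadicalFiltration n R') {k : ℕ} (hk : k ≤ n) :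
    R k = R' k := by
  have h : n - (n - k) = k := by omega
  have h1 := hR.le hR'.isSemisimpleSeries k hk hk
  have h2 := hR'.le hR.isSemisimpleSeries k hk hk
  simp only [h] at h1 h2
  exact le_antisymm h1 h2

/-- Iterate "preimage of the socle of the quotient". As long as the quotient is nonzero it has a
simple subobject (Artinian), so the chain grows strictly; it stops by the Noetherian condition. -/
lemma exists_isSocleFiltration (X : D) [IsNoetherianObject X]
    (hN : ∀ Y : D, IsNoetherianObject Y) (hA : ∀ Y : D, IsArtinianObject Y) :
    ∃ (n : ℕ) (M : ℕ → Subobject X), IsSocleFiltration n M := by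
  choose soc hsoc using fun Y : D => haveI := hN Y; exists_isSocle Y
  let next : Subobject X → Subobject X := fun M =>
    (Subobject.pullback (cokernel.π M.arrow)).obj (soc (cokernel M.arrow))
  have hpb := fun M : Subobject X =>
    Subobject.isPullback (cokernel.π M.arrow) (soc (cokernel M.arrow))
  have hle : ∀ M, M ≤ next M := fun M =>
    Subobject.le_of_comm ((hpb M).lift 0 M.arrow (by simp)) ((hpb M).lift_snd _ _ _)
  have hlt : ∀ M, M ≠ ⊤ → M < next M := by
    intro M hM
    refine lt_of_le_not_ge (hle M) fun hge => hM ?_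
    have hw := (hpb M).w
    have : Epi (Subobject.pullbackπ (cokernel.π M.arrow) (soc (cokernel M.arrow))) :=
      Abelian.epi_fst_of_isLimit _ _ (hpb M).isLimit
    have h0 : (soc (cokernel M.arrow)).arrow = 0 := by
      rw [← cancel_epi (Subobject.pullbackπ (cokernel.π M.arrow) (soc (cokernel M.arrow))), hw,
        comp_zero]
      change (next M).arrow ≫ _ = 0
      rw [← Subobject.ofLE_arrow hge, Category.assoc, cokernel.condition, comp_zero]
    by_contra _
    have hz : ¬ IsZero (cokernel M.arrow) := by
      intro hz
      have : Epi M.arrow := Preadditive.epi_of_cokernel_zero (hz.eq_of_tgt _ _)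
      have : IsIso M.arrow := isIso_of_mono_of_epi _
      exact hM (Subobject.eq_top_of_isIso_arrow M)
    have := hA (cokernel M.arrow)
    obtain ⟨T, hT⟩ := exists_simple_subobject hz
    obtain ⟨l, hl⟩ := (hsoc (cokernel M.arrow)).factors (.of_simple (T : D)) T.arrow
    rw [h0, comp_zero] at hl
    refine Simple.not_isZero (T : D) ((IsZero.iff_id_eq_zero _).2 ?_)
    rw [← cancel_mono T.arrow, ← hl, comp_zero, comp_zero]
  let M : ℕ → Subobject X := fun k => next^[k] ⊥
  have hMs : ∀ k, M (k + 1) = next (M k) := fun k => Function.iterate_succ_apply' _ _ _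
  have hex : ∃ n, M n = ⊤ := by
    obtain ⟨n, hn⟩ := monotone_chain_condition_of_isNoetherianObject
      (⟨M, monotone_nat_of_le_succ fun k => by rw [hMs]; exact hle _⟩ : ℕ →o Subobject X)
    refine ⟨n, ?_⟩
    by_contra h
    have h1 := hlt _ h
    rw [← hMs] at h1
    exact h1.ne (hn (n + 1) (by omega))
  classical
  -- The length must be the first index where `⊤` is reached, since strictness fails from there on.
  refine ⟨Nat.find hex, M, ⟨(isZero_zero D).of_iso Subobject.botCoeIsoZero, Nat.find_spec hex,
    fun k hk => ?_⟩, fun k hk => ?_⟩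
  · rw [hMs]
    exact hlt _ (Nat.find_min hex hk)
  · refine ⟨_, cokernel.π (M k).arrow, cokernel.condition _, .mk (ShortComplex.exact_cokernel _),
      _, hsoc _, ?_⟩
    rw [hMs]
    exact ⟨_, hpb (M k)⟩

lemma exists_isRadicalFiltration (X : D) [IsArtinianObject X]
    (hN : ∀ Y : D, IsNoetherianObject Y) (hA : ∀ Y : D, IsArtinianObject Y) :
    ∃ (n : ℕ) (R : ℕ → Subobject X), IsRadicalFiltration n R := by
  choose rad hrad using fun Y : D => haveI := hA Y; exists_isRadical Y
  let next : Subobject X → Subobject X := fun R => Subobject.mk ((rad (R : D)).arrow ≫ R.arrow)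
  have hle : ∀ R, next R ≤ R := fun R => Subobject.mk_le_of_comm (rad (R : D)).arrow rfl
  have hlt : ∀ R : Subobject X, ¬ IsZero (R : D) → next R < R := by
    intro R hR
    refine lt_of_le_not_ge (hle R) fun hge => ?_
    have h1 : Subobject.ofLEMk _ _ hge ≫ (rad (R : D)).arrow = 𝟙 _ := by
      rw [← cancel_mono R.arrow, Category.assoc, Subobject.ofLEMk_comp, Category.id_comp]
    have := hN (R : D)
    -- A nonzero object that equals its radical would have no simple quotient.
    obtain ⟨S, g, hS, hg⟩ := exists_simple_quotient (R : D) hR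
    have h2 : g = 0 := by
      rw [← Category.id_comp g, ← h1, Category.assoc,
        (hrad (R : D)).comp_eq_zero (.of_simple S) g, comp_zero]
    refine Simple.not_isZero S ((IsZero.iff_id_eq_zero _).2 ?_)
    rw [← cancel_epi g, h2, zero_comp, zero_comp]
  let R : ℕ → Subobject X := fun k => next^[k] ⊤
  have hRs : ∀ k, R (k + 1) = next (R k) := fun k => Function.iterate_succ_apply' _ _ _
  have hex : ∃ n, IsZero (R n : D) := by
    obtain ⟨n, hn⟩ := antitone_chain_condition_of_isArtinianObject
      (⟨R, monotone_nat_of_le_succ (α := (Subobject X)ᵒᵈ) fun k => by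
        rw [hRs]; exact hle (R k)⟩ : ℕ →o (Subobject X)ᵒᵈ)
    refine ⟨n, ?_⟩
    by_contra h
    have h1 := hlt _ h
    rw [← hRs] at h1
    exact h1.ne' (hn (n + 1) (by omega))
  classical
  refine ⟨Nat.find hex, R, rfl, Nat.find_spec hex, fun k hk => ?_, fun k hk => ?_⟩
  · rw [hRs]
    exact hlt _ (Nat.find_min hex hk)
  · exact ⟨_, hrad _, hRs k⟩

end Series

end Loewy

namespace RepA

open scoped MonObj

/-! ### Modules and module morphisms over an algebra object -/

section Hom

variable {C : Type u} [Category.{v} C] [MonoidalCategory C] {A : C} [MonObj A]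

/-- The action of `A` on a module, as a morphism of `C`. -/
def act (M : Mod C A) : A ⊗ M.X ⟶ M.X := γ[A, M.X]

lemma act_hom {M N : Mod C A} (f : M ⟶ N) : act M ≫ f.hom = A ◁ f.hom ≫ act N :=
  f.isModHom.smul_hom

lemma act_hom_assoc {M N : Mod C A} (f : M ⟶ N) {Z : C} (h : N.X ⟶ Z) :
    act M ≫ f.hom ≫ h = A ◁ f.hom ≫ act N ≫ h := by
  rw [← Category.assoc, act_hom, Category.assoc]

@[simp]
lemma one_act (M : Mod C A) : η[A] ▷ M.X ≫ act M = (λ_ M.X).hom :=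
  ModObj.one_smul_self A M.X

@[simp]
lemma one_act_assoc (M : Mod C A) {Z : C} (h : M.X ⟶ Z) :
    η[A] ▷ M.X ≫ act M ≫ h = (λ_ M.X).hom ≫ h := by
  rw [← Category.assoc, one_act]

@[simp]
lemma mul_act (M : Mod C A) : μ[A] ▷ M.X ≫ act M = (α_ A A M.X).hom ≫ A ◁ act M ≫ act M :=
  ModObj.mul_smul_self A M.X

@[simp]
lemma mul_act_assoc (M : Mod C A) {Z : C} (h : M.X ⟶ Z) :
    μ[A] ▷ M.X ≫ act M ≫ h = (α_ A A M.X).hom ≫ A ◁ act M ≫ act M ≫ h := by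
  rw [← Category.assoc, mul_act, Category.assoc, Category.assoc]

/-- Constructor for morphisms of modules. -/
def homMk {M N : Mod C A} (f : M.X ⟶ N.X) (h : act M ≫ f = A ◁ f ≫ act N) : M ⟶ N :=
  Mod.Hom.mk' f h

@[simp]
lemma homMk_hom {M N : Mod C A} (f : M.X ⟶ N.X) (h : act M ≫ f = A ◁ f ≫ act N) :
    (homMk f h).hom = f := rfl

/-- Constructor for modules. -/
def modMk (X : C) (s : A ⊗ X ⟶ X) (h₁ : η[A] ▷ X ≫ s = (λ_ X).hom)
    (h₂ : μ[A] ▷ X ≫ s = (α_ A A X).hom ≫ A ◁ s ≫ s) : Mod C A :=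
  letI : ModObj A X := { smul := s, one_smul := h₁, mul_smul := h₂ }
  ⟨X⟩

/-- A morphism through which a module morphism factors after a monomorphism is linear. -/
lemma act_of_comp_mono {M N P : Mod C A} (f : N ⟶ M) [Mono f.hom] (g : P ⟶ M)
    (l : P.X ⟶ N.X) (h : l ≫ f.hom = g.hom) : act P ≫ l = A ◁ l ≫ act N := by
  rw [← cancel_mono f.hom, Category.assoc, Category.assoc, h, act_hom, act_hom,
    ← whiskerLeft_comp_assoc, h]

lemma act_of_epi_comp {M N P : Mod C A} (f : M ⟶ N) [Epi (A ◁ f.hom)] (g : M ⟶ P)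
    (l : N.X ⟶ P.X) (h : f.hom ≫ l = g.hom) : act N ≫ l = A ◁ l ≫ act P := by
  rw [← cancel_epi (A ◁ f.hom), ← act_hom_assoc, h, act_hom, ← whiskerLeft_comp_assoc, h]

instance : (Mod.forget A : Mod C A ⥤ C).Faithful where
  map_injective h := Mod.hom_ext _ _ h

/-- A bijective module morphism is an isomorphism. -/
lemma isIso_of_isIso_hom {M N : Mod C A} (f : M ⟶ N) [IsIso f.hom] : IsIso f := by
  refine ⟨homMk (inv f.hom) ?_, ?_, ?_⟩
  · rw [IsIso.comp_inv_eq, Category.assoc, act_hom, ← whiskerLeft_comp_assoc]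
    simp
  · apply Mod.hom_ext; simp
  · apply Mod.hom_ext; simp

instance : (Mod.forget A : Mod C A ⥤ C).ReflectsIsomorphisms where
  reflects f hf := by
    have : IsIso f.hom := hf
    exact isIso_of_isIso_hom f

/-- The module structure on a subobject stable under the action. -/
def modOfMono (M : Mod C A) {K : C} (i : K ⟶ M.X) [Mono i] (s : A ⊗ K ⟶ K)
    (h : s ≫ i = A ◁ i ≫ act M) : Mod C A :=
  modMk K s
    (by
      rw [← cancel_mono i, Category.assoc, h, ← whisker_exchange_assoc]
      simp)
    (by
      rw [← cancel_mono i]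
      simp only [Category.assoc, h]
      rw [← whisker_exchange_assoc, ← whiskerLeft_comp_assoc, h]
      simp)

/-- The module structure on a quotient compatible with the action. -/
def modOfEpi (M : Mod C A) {Q : C} (p : M.X ⟶ Q) [Epi p] [Epi (A ◁ p)] [Epi (A ◁ A ◁ p)]
    (s : A ⊗ Q ⟶ Q) (h : A ◁ p ≫ s = act M ≫ p) : Mod C A :=
  modMk Q s
    (by
      have : Epi (𝟙_ C ◁ p) := by rw [id_whiskerLeft]; infer_instance
      rw [← cancel_epi (𝟙_ C ◁ p), whisker_exchange_assoc, h]
      simp)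
    (by
      have : Epi ((A ⊗ A) ◁ p) := by rw [tensor_whiskerLeft]; infer_instance
      rw [← cancel_epi ((A ⊗ A) ◁ p), whisker_exchange_assoc, h]
      simp only [tensor_whiskerLeft, Category.assoc, Iso.inv_hom_id_assoc, mul_act_assoc]
      rw [← whiskerLeft_comp_assoc, h, whiskerLeft_comp_assoc, h])

end Hom

/-! ### Induction as left adjoint of the forgetful functor -/

section Adjunction

variable {C : Type u} [Category.{v} C] [MonoidalCategory C] (A : C) [MonObj A]

lemma act_induction_obj (X : C) :
    act ((induction A).obj X) = (α_ A A X).inv ≫ μ[A] ▷ X := rfl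

variable {A}

/-- The morphism `η ▷ X ≫ f`, for `f : A ⊗ X ⟶ Y`. -/
def restr {X Y : C} (f : A ⊗ X ⟶ Y) : X ⟶ Y := (λ_ X).inv ≫ η[A] ▷ X ≫ f

/-- The linear extension of a morphism to a module. -/
def ext {X : C} {M : Mod C A} (g : X ⟶ M.X) : (induction A).obj X ⟶ M :=
  homMk (show A ⊗ X ⟶ M.X from A ◁ g ≫ act M) (by
    rw [act_induction_obj]
    change ((α_ A A X).inv ≫ μ[A] ▷ X) ≫ A ◁ g ≫ act M = A ◁ (A ◁ g ≫ act M) ≫ act M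
    rw [Category.assoc, ← whisker_exchange_assoc]
    simp)

lemma ext_hom {X : C} {M : Mod C A} (g : X ⟶ M.X) : (ext g).hom = A ◁ g ≫ act M := rfl

lemma restr_ext {X : C} {M : Mod C A} (g : X ⟶ M.X) : restr (ext g).hom = g := by
  change (λ_ X).inv ≫ η[A] ▷ X ≫ A ◁ g ≫ act M = g
  rw [← whisker_exchange_assoc]
  simp

/-- In elements, `a · f (1 ⊗ x) = f (a ⊗ x)` by linearity and the right unit law. -/
lemma whiskerLeft_restr {X Y : C} (f : A ⊗ X ⟶ Y) (s : A ⊗ Y ⟶ Y)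
    (h : ((α_ A A X).inv ≫ μ[A] ▷ X) ≫ f = A ◁ f ≫ s) : A ◁ restr f ≫ s = f := by
  simp only [restr]
  rw [whiskerLeft_comp, whiskerLeft_comp, Category.assoc, Category.assoc, ← h,
    Category.assoc, associator_inv_naturality_middle_assoc, ← comp_whiskerRight_assoc,
    MonObj.mul_one]
  simp

lemma ext_restr {X : C} {M : Mod C A} (f : (induction A).obj X ⟶ M) :
    ext (M := M) (restr (show A ⊗ X ⟶ M.X from f.hom)) = f := by
  apply Mod.hom_ext
  rw [ext_hom]
  exact whiskerLeft_restr (show A ⊗ X ⟶ M.X from f.hom) (act M) (act_hom f)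

variable (A)

/-- Induction is left adjoint to the forgetful functor. -/
def inductionAdj : induction A ⊣ Mod.forget A :=
  Adjunction.mkOfHomEquiv
    { homEquiv := fun X M =>
        { toFun := fun f => restr (show A ⊗ X ⟶ M.X from f.hom)
          invFun := fun g => ext (M := M) g
          left_inv := fun f => ext_restr f
          right_inv := fun g => restr_ext (M := M) g }
      homEquiv_naturality_left_symm := fun {X X' M} f g => by
        apply Mod.hom_ext
        change A ◁ (f ≫ (show X' ⟶ M.X from g)) ≫ act M =
          A ◁ f ≫ A ◁ (show X' ⟶ M.X from g) ≫ act M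
        rw [whiskerLeft_comp, Category.assoc]
      homEquiv_naturality_right := fun {X M N} f g => by
        change (λ_ X).inv ≫ η[A] ▷ X ≫ (show A ⊗ X ⟶ M.X from f.hom) ≫ g.hom =
          ((λ_ X).inv ≫ η[A] ▷ X ≫ (show A ⊗ X ⟶ M.X from f.hom)) ≫ g.hom
        rw [Category.assoc, Category.assoc] }

instance : (Mod.forget A : Mod C A ⥤ C).IsRightAdjoint := (inductionAdj A).isRightAdjoint

variable {A} in
lemma mono_hom_of_mono {M N : Mod C A} (f : M ⟶ N) [Mono f] : Mono f.hom :=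
  inferInstanceAs (Mono ((Mod.forget A).map f))

instance : (induction A).IsLeftAdjoint := (inductionAdj A).isLeftAdjoint

end Adjunction

/-! ### The abelian category of modules and exactness of induction -/

section Abelian

variable {C : Type u} [Category.{v} C] [Abelian C] [MonoidalCategory C] [MonoidalPreadditive C]
  (A : C) [MonObj A]

instance : (Mod.forget A : Mod C A ⥤ C).Additive where

instance : (induction A).Additive where
  map_add {X Y f g} := by
    apply Mod.hom_ext
    exact MonoidalPreadditive.whiskerLeft_add _ _

instance : HasZeroObject (Mod C A) := by
  let M : Mod C A := modMk (0 : C) 0 (by rw [comp_zero]; exact (isZero_zero C).eq_of_tgt _ _)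
    (by simp)
  exact ⟨M, (IsZero.iff_id_eq_zero M).2 (Mod.hom_ext _ _ ((isZero_zero C).eq_of_src _ _))⟩

instance : HasBinaryBiproducts (Mod C A) where
  has_binary_biproduct M N := by
    let P : Mod C A := modMk (M.X ⊞ N.X)
      (biprod.lift (A ◁ biprod.fst ≫ act M) (A ◁ biprod.snd ≫ act N))
      (by
        ext
        · simp only [Category.assoc, biprod.lift_fst]
          rw [← whisker_exchange_assoc]; simp
        · simp only [Category.assoc, biprod.lift_snd]
          rw [← whisker_exchange_assoc]; simp)
      (by
        ext
        · simp only [Category.assoc, biprod.lift_fst]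
          rw [← whisker_exchange_assoc, ← whiskerLeft_comp_assoc, biprod.lift_fst]; simp
        · simp only [Category.assoc, biprod.lift_snd]
          rw [← whisker_exchange_assoc, ← whiskerLeft_comp_assoc, biprod.lift_snd]; simp)
    have hP : act P = biprod.lift (A ◁ biprod.fst ≫ act M) (A ◁ biprod.snd ≫ act N) := rfl
    let fst : P ⟶ M := homMk (show M.X ⊞ N.X ⟶ M.X from biprod.fst) (by
      rw [hP]; exact biprod.lift_fst _ _)
    let snd : P ⟶ N := homMk (show M.X ⊞ N.X ⟶ N.X from biprod.snd) (by
      rw [hP]; exact biprod.lift_snd _ _)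
    let inl : M ⟶ P := homMk (show M.X ⟶ M.X ⊞ N.X from biprod.inl) (by
      rw [hP]
      change act M ≫ biprod.inl = A ◁ biprod.inl ≫
        biprod.lift (A ◁ biprod.fst ≫ act M) (A ◁ biprod.snd ≫ act N)
      ext
      · simp [← whiskerLeft_comp_assoc]
      · simp [← whiskerLeft_comp_assoc])
    let inr : N ⟶ P := homMk (show N.X ⟶ M.X ⊞ N.X from biprod.inr) (by
      rw [hP]
      change act N ≫ biprod.inr = A ◁ biprod.inr ≫
        biprod.lift (A ◁ biprod.fst ≫ act M) (A ◁ biprod.snd ≫ act N)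
      ext
      · simp [← whiskerLeft_comp_assoc]
      · simp [← whiskerLeft_comp_assoc])
    let b : BinaryBicone M N :=
      { pt := P, fst := fst, snd := snd, inl := inl, inr := inr
        inl_fst := Mod.hom_ext _ _ biprod.inl_fst
        inl_snd := Mod.hom_ext _ _ biprod.inl_snd
        inr_fst := Mod.hom_ext _ _ biprod.inr_fst
        inr_snd := Mod.hom_ext _ _ biprod.inr_snd }
    exact HasBinaryBiproduct.mk
      ⟨b, isBinaryBilimitOfTotal b (Mod.hom_ext _ _ (biprod.total (X := M.X) (Y := N.X)))⟩

instance : HasFiniteProducts (Mod C A) := hasFiniteProducts_of_has_binary_and_terminal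

variable {A}

/-- The kernel of a module morphism. -/
noncomputable def kernelMod {M N : Mod C A} (f : M ⟶ N) : Mod C A :=
  modOfMono M (kernel.ι f.hom)
    (kernel.lift f.hom (A ◁ kernel.ι f.hom ≫ act M) (by
      rw [Category.assoc, act_hom, ← whiskerLeft_comp_assoc, kernel.condition]
      simp))
    (kernel.lift_ι _ _ _)

/-- The inclusion of the kernel of a module morphism. -/
noncomputable def kernelMod.ι {M N : Mod C A} (f : M ⟶ N) : kernelMod f ⟶ M :=
  homMk (show kernel f.hom ⟶ M.X from kernel.ι f.hom) (kernel.lift_ι _ _ _)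

instance {M N : Mod C A} (f : M ⟶ N) : Mono (kernelMod.ι f).hom :=
  inferInstanceAs (Mono (kernel.ι f.hom))

lemma kernelMod.condition {M N : Mod C A} (f : M ⟶ N) : kernelMod.ι f ≫ f = 0 :=
  Mod.hom_ext _ _ (kernel.condition f.hom)

/-- A fork of modules that is a kernel in `C` is a kernel of modules. -/
noncomputable def isLimitKernelFork {K M N : Mod C A} (f : M ⟶ N) (i : K ⟶ M) (w : i ≫ f = 0)
    [Mono i.hom] (h : ∀ {T : C} (x : T ⟶ M.X), x ≫ f.hom = 0 → ∃ l : T ⟶ K.X, l ≫ i.hom = x) :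
    IsLimit (KernelFork.ofι i w) :=
  have : Mono i := (Mod.forget A).mono_of_mono_map (inferInstanceAs (Mono i.hom))
  KernelFork.IsLimit.ofι' i w fun g hg =>
    have hg' : g.hom ≫ f.hom = 0 := congrArg Mod.Hom.hom hg
    ⟨homMk (h g.hom hg').choose (act_of_comp_mono i g _ (h g.hom hg').choose_spec),
      Mod.hom_ext _ _ (h g.hom hg').choose_spec⟩

instance : HasKernels (Mod C A) where
  has_limit f := ⟨⟨_, isLimitKernelFork f (kernelMod.ι f) (kernelMod.condition f)
    fun x hx => ⟨kernel.lift f.hom x hx, kernel.lift_ι _ _ _⟩⟩⟩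

variable [PreservesFiniteColimits (tensorLeft A)]

instance epi_whiskerLeft {X Y : C} (p : X ⟶ Y) [Epi p] : Epi (A ◁ p) :=
  inferInstanceAs (Epi ((tensorLeft A).map p))

/-- Right exactness of `A ⊗ -` makes `A ⊗ cokernel f.hom` a cokernel of `A ◁ f.hom`, so the action
descends. -/
lemma exists_act_cokernel {M N : Mod C A} (f : M ⟶ N) :
    ∃ s : A ⊗ cokernel f.hom ⟶ cokernel f.hom,
      A ◁ cokernel.π f.hom ≫ s = act N ≫ cokernel.π f.hom :=
  ⟨(isColimitOfHasCokernelOfPreservesColimit (tensorLeft A) f.hom).desc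
    (CokernelCofork.ofπ (act N ≫ cokernel.π f.hom) (by
      change A ◁ f.hom ≫ _ = 0
      rw [← act_hom_assoc, cokernel.condition, comp_zero])),
    (isColimitOfHasCokernelOfPreservesColimit (tensorLeft A) f.hom).fac _
      WalkingParallelPair.one⟩

/-- The cokernel of a module morphism. -/
noncomputable def cokernelMod {M N : Mod C A} (f : M ⟶ N) : Mod C A :=
  modOfEpi N (cokernel.π f.hom) (exists_act_cokernel f).choose (exists_act_cokernel f).choose_spec

/-- The projection to the cokernel of a module morphism. -/
noncomputable def cokernelMod.π {M N : Mod C A} (f : M ⟶ N) : N ⟶ cokernelMod f :=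
  homMk (show N.X ⟶ cokernel f.hom from cokernel.π f.hom) (exists_act_cokernel f).choose_spec.symm

instance {M N : Mod C A} (f : M ⟶ N) : Epi (cokernelMod.π f).hom :=
  inferInstanceAs (Epi (cokernel.π f.hom))

lemma cokernelMod.condition {M N : Mod C A} (f : M ⟶ N) : f ≫ cokernelMod.π f = 0 :=
  Mod.hom_ext _ _ (cokernel.condition f.hom)

/-- A cofork of modules that is a cokernel in `C` is a cokernel of modules. -/
noncomputable def isColimitCokernelCofork {M N Q : Mod C A} (f : M ⟶ N) (p : N ⟶ Q)
    (w : f ≫ p = 0) [Epi p.hom]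
    (h : ∀ {T : C} (x : N.X ⟶ T), f.hom ≫ x = 0 → ∃ l : Q.X ⟶ T, p.hom ≫ l = x) :
    IsColimit (CokernelCofork.ofπ p w) :=
  have : Epi p := (Mod.forget A).epi_of_epi_map (inferInstanceAs (Epi p.hom))
  CokernelCofork.IsColimit.ofπ' p w fun g hg =>
    have hg' : f.hom ≫ g.hom = 0 := congrArg Mod.Hom.hom hg
    ⟨homMk (h g.hom hg').choose (act_of_epi_comp p g _ (h g.hom hg').choose_spec),
      Mod.hom_ext _ _ (h g.hom hg').choose_spec⟩

/-- The cokernel of modules is computed in `C`. -/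
noncomputable def isColimitCokernelMod {M N : Mod C A} (f : M ⟶ N) :
    IsColimit (CokernelCofork.ofπ (cokernelMod.π f) (cokernelMod.condition f)) :=
  isColimitCokernelCofork f _ _ fun x hx =>
    ⟨cokernel.desc f.hom x hx, cokernel.π_desc _ _ _⟩

instance : HasCokernels (Mod C A) where
  has_colimit f := ⟨⟨_, isColimitCokernelMod f⟩⟩

/-- The cokernel of modules has the cokernel in `C` underlying it, and it vanishes for an
epimorphism. -/
lemma epi_hom_of_epi {M N : Mod C A} (f : M ⟶ N) [Epi f] : Epi f.hom := by
  have h : cokernelMod.π f = 0 := by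
    rw [← cancel_epi f, cokernelMod.condition, comp_zero]
  exact Preadditive.epi_of_cokernel_zero (congrArg Mod.Hom.hom h)

variable (A)

/-- Modules over an algebra with right exact tensor product form an abelian category. -/
@[reducible]
noncomputable def modAbelian : Abelian (Mod C A) where
  toPreadditive := inferInstance
  normalMonoOfMono f _ := by
    have := mono_hom_of_mono f
    exact ⟨⟨_, cokernelMod.π f, cokernelMod.condition f, isLimitKernelFork _ _ _ fun x hx =>
      ⟨Abelian.monoLift f.hom x hx, Abelian.monoLift_comp _ _ _⟩⟩⟩
  normalEpiOfEpi f _ := by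
    have := epi_hom_of_epi f
    exact ⟨⟨_, kernelMod.ι f, kernelMod.condition f, isColimitCokernelCofork _ _ _ fun x hx =>
      ⟨Abelian.epiDesc f.hom x hx, Abelian.comp_epiDesc _ _ _⟩⟩⟩

attribute [local instance] modAbelian

instance : PreservesFiniteColimits (Mod.forget A : Mod C A ⥤ C) := by
  have : ∀ {M N : Mod C A} (f : M ⟶ N), PreservesColimit (parallelPair f 0) (Mod.forget A) := by
    intro M N f
    refine preservesColimit_of_preserves_colimit_cocone (isColimitCokernelMod f) ?_
    exact (isColimitMapCoconeCoforkEquiv' (Mod.forget A) (cokernelMod.condition f)).symm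
      (cokernelIsCokernel f.hom)
  exact Functor.preservesFiniteColimits_of_preservesCokernels _

/-- Followed by the forgetful functor, induction is `A ⊗ -`; the forgetful functor is conservative
and preserves limits, so it reflects them. -/
instance [PreservesFiniteLimits (tensorLeft A)] : PreservesFiniteLimits (induction A) where
  preservesFiniteLimits J _ _ := by
    have : PreservesLimitsOfShape J (induction A ⋙ Mod.forget A) :=
      inferInstanceAs (PreservesLimitsOfShape J (tensorLeft A))
    have : ReflectsLimitsOfShape J (Mod.forget A : Mod C A ⥤ C) :=
      reflectsLimitsOfShape_of_reflectsIsomorphisms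
    exact preservesLimitsOfShape_of_reflects_of_preserves (induction A) (Mod.forget A)

end Abelian

end RepA

namespace Loewy

/-! ### Transport of filtrations and diagrams along exact functors -/

section Transport

variable {D : Type u} [Category.{v} D] [Abelian D]

lemma IsRadical.of_iso {Y Y' : D} {P : Subobject Y} (hP : IsRadical P) (e : Y ≅ Y') :
    IsRadical (Subobject.mk (P.arrow ≫ e.hom)) := by
  obtain ⟨Z, ⟨g, w, hg⟩, hZ⟩ := hP.1
  refine isRadical_of_comp_eq_zero hZ (.comp_eq (f := P.arrow ≫ e.hom)
    ⟨e.inv ≫ g, by simp [w], ?_⟩ (Subobject.underlyingIso _) (by simp)) fun W f hW => ?_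
  · exact ShortComplex.shortExact_of_iso (S₁ := ShortComplex.mk P.arrow g w)
      (ShortComplex.isoMk (Iso.refl _) e (Iso.refl _) (by simp) (by simp)) hg
  · rw [← Subobject.underlyingIso_hom_comp_eq_mk, Category.assoc, Category.assoc,
      hP.comp_eq_zero hW (e.hom ≫ f), comp_zero]

end Transport

section DirectSum

variable {D : Type u} [Category.{v} D] {D' : Type u'} [Category.{v'} D'] (F : D ⥤ D')
  [PreservesFiniteColimits F]

lemma IsDirectSum.map {m : ℕ} {X : D} {S : Fin m → D} (h : IsDirectSum X S) :
    IsDirectSum (F.obj X) fun i => F.obj (S i) := by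
  obtain ⟨ι, ⟨hι⟩⟩ := h
  exact ⟨fun i => F.map (ι i), ⟨isColimitCofanMkObjOfIsColimit F S ι hι⟩⟩

end DirectSum

section MapsTo

variable {D : Type u} [Category.{v} D] {D' : Type u'} [Category.{v'} D'] {F : D ⥤ D'}

lemma MapsTo.le {X : D} {P Q : Subobject X} {N K : Subobject (F.obj X)} (hP : MapsTo F P N)
    (hQ : MapsTo F Q K) (h : P ≤ Q) : N ≤ K := by
  obtain ⟨e, he⟩ := hP
  obtain ⟨e', he'⟩ := hQ
  refine Subobject.le_of_comm (e.inv ≫ F.map (P.ofLE Q h) ≫ e'.hom) ?_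
  rw [Category.assoc, Category.assoc, he', ← F.map_comp, Subobject.ofLE_arrow, ← he,
    Iso.inv_hom_id_assoc]

variable [Preadditive D] [Preadditive D'] [F.Additive]

lemma MapsTo.isZero {X : D} {P : Subobject X} {N : Subobject (F.obj X)}
    (hP : MapsTo F P N) (h : IsZero (P : D)) : IsZero (N : D') :=
  (F.map_isZero h).of_iso hP.choose.symm

end MapsTo

section ExactFunctor

variable {D : Type u} [Category.{v} D] [Abelian D] {D' : Type u'} [Category.{v'} D'] [Abelian D']
  (F : D ⥤ D') [F.Additive] [PreservesFiniteLimits F] [PreservesFiniteColimits F]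

lemma IsQuotient.map {X Y Z : D} {f : X ⟶ Y} (h : IsQuotient f Z) :
    IsQuotient (F.map f) (F.obj Z) := by
  obtain ⟨g, w, hg⟩ := h
  exact ⟨F.map g, by rw [← F.map_comp, w, F.map_zero], hg.map_of_exact F⟩

/-- The image of a subobject under a functor preserving monomorphisms. -/
noncomputable def mapSubobject {X : D} (P : Subobject X) : Subobject (F.obj X) :=
  Subobject.mk (F.map P.arrow)

/-- The image of a subobject is the image of the underlying object. -/
noncomputable def mapSubobjectIso {X : D} (P : Subobject X) :
    F.obj (P : D) ≅ (mapSubobject F P : D') :=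
  (Subobject.underlyingIso (F.map P.arrow)).symm

@[simp]
lemma mapSubobjectIso_hom_arrow {X : D} (P : Subobject X) :
    (mapSubobjectIso F P).hom ≫ (mapSubobject F P).arrow = F.map P.arrow :=
  Subobject.underlyingIso_arrow _

@[simp]
lemma mapSubobjectIso_hom_arrow_assoc {X : D} (P : Subobject X) {Z : D'} (h : F.obj X ⟶ Z) :
    (mapSubobjectIso F P).hom ≫ (mapSubobject F P).arrow ≫ h = F.map P.arrow ≫ h := by
  rw [← Category.assoc, mapSubobjectIso_hom_arrow]

@[simp]
lemma mapSubobjectIso_inv_map {X : D} (P : Subobject X) :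
    (mapSubobjectIso F P).inv ≫ F.map P.arrow = (mapSubobject F P).arrow := by
  rw [Iso.inv_comp_eq, mapSubobjectIso_hom_arrow]

lemma mapsTo_mapSubobject {X : D} (P : Subobject X) : MapsTo F P (mapSubobject F P) :=
  ⟨mapSubobjectIso F P, mapSubobjectIso_hom_arrow F P⟩

variable {F}

/-- The reverse inclusion upstairs makes `F` of the inclusion `P ⟶ Q` a split epimorphism, and
faithful functors reflect epimorphisms. This keeps filtrations strict, hence their length. -/
lemma MapsTo.le_of_le [F.Faithful] {X : D} {P Q : Subobject X} {N K : Subobject (F.obj X)}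
    (hP : MapsTo F P N) (hQ : MapsTo F Q K) (hPQ : P ≤ Q) (h : K ≤ N) : Q ≤ P := by
  obtain ⟨e, he⟩ := hP
  obtain ⟨e', he'⟩ := hQ
  have h1 : (e'.hom ≫ K.ofLE N h ≫ e.inv) ≫ F.map (P.ofLE Q hPQ) = 𝟙 _ := by
    rw [← cancel_mono (F.map Q.arrow)]
    simp only [Category.assoc, ← F.map_comp, Subobject.ofLE_arrow]
    rw [← he, Iso.inv_hom_id_assoc, Subobject.ofLE_arrow, he', Category.id_comp]
  have h2 : Epi (F.map (P.ofLE Q hPQ)) := (SplitEpi.mk _ h1).epi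
  have h3 : Epi (P.ofLE Q hPQ) := F.epi_of_epi_map h2
  have : IsIso (P.ofLE Q hPQ) := isIso_of_mono_of_epi _
  exact Subobject.le_of_comm (inv (P.ofLE Q hPQ)) (by simp)

lemma MapsTo.lt [F.Faithful] {X : D} {P Q : Subobject X} {N K : Subobject (F.obj X)}
    (hP : MapsTo F P N) (hQ : MapsTo F Q K) (h : P < Q) : N < K :=
  lt_of_le_not_ge (hP.le hQ h.le) fun hle => h.not_ge (hP.le_of_le hQ h.le hle)

lemma mapSubobject_top (X : D) : mapSubobject F (⊤ : Subobject X) = ⊤ :=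
  (Subobject.isIso_iff_mk_eq_top _).1 inferInstance

lemma MapsTo.isSubobjectQuotient {X : D} {P Q : Subobject X} {N K : Subobject (F.obj X)}
    (hP : MapsTo F P N) (hQ : MapsTo F Q K) {Z : D} (h : IsSubobjectQuotient P Q Z) :
    IsSubobjectQuotient N K (F.obj Z) := by
  obtain ⟨hle, g, w, hg⟩ := h
  have hle' := hP.le hQ hle
  obtain ⟨e, he⟩ := hP
  obtain ⟨e', he'⟩ := hQ
  have hc : e.hom ≫ N.ofLE K hle' = F.map (P.ofLE Q hle) ≫ e'.hom := by
    rw [← cancel_mono K.arrow, Category.assoc, Category.assoc, Subobject.ofLE_arrow, he, he',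
      ← F.map_comp, Subobject.ofLE_arrow]
  have hw : N.ofLE K hle' ≫ e'.inv ≫ F.map g = 0 := by
    rw [← cancel_epi e.hom, reassoc_of% hc, Iso.hom_inv_id_assoc, ← F.map_comp, w, F.map_zero,
      comp_zero]
  exact ⟨hle', e'.inv ≫ F.map g, hw, ShortComplex.shortExact_of_iso
    (S₁ := (ShortComplex.mk _ g w).map F) (S₂ := ShortComplex.mk _ _ hw)
    (ShortComplex.isoMk e e' (Iso.refl (F.obj Z)) hc
      ((Iso.hom_inv_id_assoc e' _).trans (Category.comp_id _).symm)) (hg.map_of_exact F)⟩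

variable (F)

lemma IsSocleFiltration.map [F.Faithful]
    (hF : ∀ (X : D) (P : Subobject X), IsSocle P → IsSocle (mapSubobject F P))
    {X : D} {n : ℕ} {M : ℕ → Subobject X} (hM : IsSocleFiltration n M) :
    IsSocleFiltration n fun k => mapSubobject F (M k) := by
  refine ⟨⟨(mapsTo_mapSubobject F _).isZero hM.zero, ?_, fun k hk =>
    (mapsTo_mapSubobject F _).lt (mapsTo_mapSubobject F _) (hM.strict k hk)⟩, fun k hk => ?_⟩
  · simp only [hM.top]
    exact mapSubobject_top X
  · obtain ⟨Z, g, hg, hS, P, hP, t, ht⟩ := hM.step k hk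
    have hw : (mapSubobject F (M k)).arrow ≫ F.map g = 0 := by
      rw [← mapSubobjectIso_inv_map, Category.assoc, ← F.map_comp, hg, F.map_zero, comp_zero]
    refine ⟨F.obj Z, F.map g, hw, ShortComplex.shortExact_of_iso
      (S₁ := (ShortComplex.mk _ g hg).map F) (S₂ := ShortComplex.mk _ _ hw)
      (ShortComplex.isoMk (mapSubobjectIso F (M k)) (Iso.refl (F.obj X)) (Iso.refl (F.obj Z))
        ((mapSubobjectIso_hom_arrow F (M k)).trans (Category.comp_id _).symm)
        ((Category.id_comp _).trans (Category.comp_id _).symm))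
      (hS.map_of_exact F), mapSubobject F P, hF Z P hP,
      (mapSubobjectIso F (M (k + 1))).inv ≫ F.map t ≫ (mapSubobjectIso F P).hom, ?_⟩
    exact IsPullback.of_iso (ht.map F) (mapSubobjectIso F (M (k + 1)))
      (mapSubobjectIso F P) (Iso.refl _) (Iso.refl _) (by simp) (by simp) (by simp) (by simp)

lemma IsRadicalFiltration.map [F.Faithful]
    (hF : ∀ (X : D) (P : Subobject X), IsRadical P → IsRadical (mapSubobject F P))
    {X : D} {n : ℕ} {R : ℕ → Subobject X} (hR : IsRadicalFiltration n R) :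
    IsRadicalFiltration n fun k => mapSubobject F (R k) := by
  refine ⟨?_, (mapsTo_mapSubobject F _).isZero hR.zero, fun k hk =>
    (mapsTo_mapSubobject F _).lt (mapsTo_mapSubobject F _) (hR.strict k hk), fun k hk => ?_⟩
  · simp only [hR.top]
    exact mapSubobject_top X
  · obtain ⟨P, hP, hPR⟩ := hR.step k hk
    -- `hF` gives the radical of `F (R k)`, which is only isomorphic to the object underlying the
    -- image subobject.
    refine ⟨_, (hF _ P hP).of_iso (mapSubobjectIso F (R k)), ?_⟩
    obtain ⟨e, he⟩ : ∃ e : (R (k + 1) : D) ≅ (P : D),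
        e.hom ≫ P.arrow ≫ (R k).arrow = (R (k + 1)).arrow :=
      ⟨Subobject.isoOfEq _ _ hPR ≪≫ Subobject.underlyingIso (P.arrow ≫ (R k).arrow), by simp⟩
    refine Subobject.mk_eq_mk_of_comm _ _
      (F.mapIso e ≪≫ mapSubobjectIso F P ≪≫ (Subobject.underlyingIso _).symm) ?_
    simp [← he]

lemma IsLayer.map (hS : ∀ S : D, Simple S → Simple (F.obj S)) {X : D} {n : ℕ}
    {M : ℕ → Subobject X} {N : ℕ → Subobject (F.obj X)} (h : ∀ k ≤ n, MapsTo F (M k) (N k))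
    {k : ℕ} (hk : k < n) {m : ℕ} {S : Fin m → D} (hL : IsLayer M k S) :
    IsLayer N k fun i => F.obj (S i) := by
  obtain ⟨hs, Z, hZ, hZS⟩ := hL
  exact ⟨fun i => hS _ (hs i), F.obj Z,
    (h k hk.le).isSubobjectQuotient (h (k + 1) hk) hZ, hZS.map F⟩

lemma InLayer.map (hS : ∀ S : D, Simple S → Simple (F.obj S)) {X : D} {n : ℕ}
    {M : ℕ → Subobject X} {N : ℕ → Subobject (F.obj X)} (h : ∀ k ≤ n, MapsTo F (M k) (N k))
    {k : ℕ} (hk : k < n) {Y : D} (hL : InLayer M k Y) : InLayer N k (F.obj Y) := by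
  obtain ⟨m, S, hS', i, ⟨e⟩⟩ := hL
  exact ⟨m, _, hS'.map F hS h hk, i, ⟨F.mapIso e⟩⟩

lemma preservesDiagram_of_mapsTo (hS : ∀ S : D, Simple S → Simple (F.obj S))
    (hE : ∀ Y' E Y : D, HasNonsplitSequence Y' E Y →
      HasNonsplitSequence (F.obj Y') (F.obj E) (F.obj Y)) {X : D} {n : ℕ}
    {M : ℕ → Subobject X} {N : ℕ → Subobject (F.obj X)} (h : ∀ k ≤ n, MapsTo F (M k) (N k)) :
    PreservesDiagram F n M N where
  layers _ hk _ _ hL := hL.map F hS h hk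
  arrows k hk Y Y' := by
    rintro ⟨h1, h2, W, hW, E, ⟨P, i, q, _, _⟩, hEs⟩
    exact ⟨h1.map F hS h (by omega), h2.map F hS h (by omega), F.obj W,
      (h k (by omega)).isSubobjectQuotient (h (k + 2) hk) hW, F.obj E,
      ⟨F.obj P, F.map i, F.map q, inferInstance, inferInstance⟩, hE _ _ _ hEs⟩

lemma preservesSocleFiltrations [F.Faithful] (hA : ∀ X : D, IsArtinianObject X)
    (hN : ∀ X : D, IsNoetherianObject X)
    (hF : ∀ (X : D) (P : Subobject X), IsSocle P → IsSocle (mapSubobject F P)) :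
    PreservesSocleFiltrations F := fun X =>
  ⟨haveI := hN X; exists_isSocleFiltration X hN hA, fun _ _ hM =>
    ⟨hM.isLoewyLength, (hM.map F hF).isLoewyLength, _, hM.map F hF,
      fun _ _ => mapsTo_mapSubobject F _⟩⟩

lemma preservesRadicalFiltrations [F.Faithful] (hA : ∀ X : D, IsArtinianObject X)
    (hN : ∀ X : D, IsNoetherianObject X)
    (hF : ∀ (X : D) (P : Subobject X), IsRadical P → IsRadical (mapSubobject F P)) :
    PreservesRadicalFiltrations F := fun X =>
  ⟨haveI := hA X; exists_isRadicalFiltration X hN hA, fun _ _ hR =>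
    ⟨hR.isLoewyLength, (hR.map F hF).isLoewyLength, _, hR.map F hF,
      fun _ _ => mapsTo_mapSubobject F _⟩⟩

lemma preservesSocleDiagrams [F.Faithful]
    (hF : ∀ (X : D) (P : Subobject X), IsSocle P → IsSocle (mapSubobject F P))
    (hS : ∀ S : D, Simple S → Simple (F.obj S))
    (hE : ∀ Y' E Y : D, HasNonsplitSequence Y' E Y →
      HasNonsplitSequence (F.obj Y') (F.obj E) (F.obj Y)) :
    PreservesSocleDiagrams F := fun _ _ M _ hM hN =>
  preservesDiagram_of_mapsTo F hS hE fun k hk => by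
    rw [hN.eq (hM.map F hF) hk]
    exact mapsTo_mapSubobject F (M k)

lemma preservesRadicalDiagrams [F.Faithful]
    (hF : ∀ (X : D) (P : Subobject X), IsRadical P → IsRadical (mapSubobject F P))
    (hS : ∀ S : D, Simple S → Simple (F.obj S))
    (hE : ∀ Y' E Y : D, HasNonsplitSequence Y' E Y →
      HasNonsplitSequence (F.obj Y') (F.obj E) (F.obj Y)) :
    PreservesRadicalDiagrams F := fun _ n R _ hR hN =>
  preservesDiagram_of_mapsTo F hS hE fun k _ => by
    rw [hN.eq (hR.map F hF) (Nat.sub_le n k)]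
    exact mapsTo_mapSubobject F (R (n - k))

end ExactFunctor

variable {D : Type u} [Category.{v} D] [Abelian D]

/-- An object covered by finitely many semisimple objects is semisimple. -/
lemma IsSemisimple.of_jointly_epi {J : Type w} [Finite J] {X : D} (T : J → D) (g : ∀ j, T j ⟶ X)
    (hT : ∀ j, IsSemisimple (T j))
    (hg : ∀ {Z : D} (h : X ⟶ Z), (∀ j, g j ≫ h = 0) → h = 0) : IsSemisimple X := by
  classical
  have := Fintype.ofFinite J
  have key : ∀ s : Finset J, ∃ (W : D) (p : W ⟶ X), IsSemisimple W ∧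
      ∀ j ∈ s, ∃ l : T j ⟶ W, l ≫ p = g j := by
    intro s
    induction s using Finset.induction_on with
    | empty => exact ⟨0, 0, .of_isZero (isZero_zero D), by simp⟩
    | insert a s _ ih =>
      obtain ⟨W, p, hW, hp⟩ := ih
      refine ⟨W ⊞ T a, biprod.desc p (g a), hW.biprod (hT a), fun j hj => ?_⟩
      rcases Finset.mem_insert.1 hj with rfl | hj
      · exact ⟨biprod.inr, biprod.inr_desc _ _⟩
      · obtain ⟨l, hl⟩ := hp j hj
        exact ⟨l ≫ biprod.inl, by simp [hl]⟩
  obtain ⟨W, p, hW, hp⟩ := key Finset.univ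
  have : Epi p := by
    refine Preadditive.epi_of_cancel_zero p fun {Z} h hh => hg h fun j => ?_
    obtain ⟨l, hl⟩ := hp j (Finset.mem_univ j)
    rw [← hl, Category.assoc, hh, comp_zero]
  exact hW.of_epi p

/-! ### Semisimplicity under equivalences -/

section Equivalence

variable {D' : Type u'} [Category.{v'} D'] [Abelian D'] (E : D ⥤ D') [E.Additive] [E.IsEquivalence]

lemma IsSemisimple.map_equivalence {V : D} (hV : IsSemisimple V) : IsSemisimple (E.obj V) :=
  hV.map E fun S _ => haveI := simple_obj E S; .of_simple _

lemma IsSemisimple.of_map_equivalence {V : D} (hV : IsSemisimple (E.obj V)) : IsSemisimple V := by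
  have : E.asEquivalence.functor.Additive := inferInstanceAs E.Additive
  have : E.inv.Additive := E.asEquivalence.inverse_additive
  exact (hV.map_equivalence E.inv).of_iso (E.asEquivalence.unitIso.app V).symm

/-- Up to isomorphism `W` and `g` come from `D`. With `p` the quotient by the socle, this says that
maps from semisimple objects to `E.obj X` land in the image of the socle. -/
lemma comp_map_eq_zero_of_isSemisimple {X Z : D} (p : X ⟶ Z)
    (hp : ∀ (V : D) (g : V ⟶ X), IsSemisimple V → g ≫ p = 0) {W : D'} (hW : IsSemisimple W)
    (g : W ⟶ E.obj X) : g ≫ E.map p = 0 := by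
  let e := E.objObjPreimageIso W
  have hV : IsSemisimple (E.objPreimage W) := (hW.of_iso e.symm).of_map_equivalence E
  rw [← cancel_epi e.hom, ← Category.assoc, ← E.map_preimage (e.hom ≫ g), ← E.map_comp,
    hp _ _ hV, E.map_zero, comp_zero]

lemma map_comp_eq_zero_of_isSemisimple {X Z : D} (p : Z ⟶ X)
    (hp : ∀ (V : D) (g : X ⟶ V), IsSemisimple V → p ≫ g = 0) {W : D'} (hW : IsSemisimple W)
    (g : E.obj X ⟶ W) : E.map p ≫ g = 0 := by
  let e := E.objObjPreimageIso W
  have hV : IsSemisimple (E.objPreimage W) := (hW.of_iso e.symm).of_map_equivalence E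
  rw [← cancel_mono e.inv, Category.assoc, ← E.map_preimage (g ≫ e.inv), ← E.map_comp,
    hp _ _ hV, E.map_zero, zero_comp]

end Equivalence

end Loewy

/-! ### Invertible objects -/

section Invertible

variable {C : Type u} [Category.{v} C] [MonoidalCategory C]

/-- Tensoring with the dual is a quasi-inverse; evaluation and coevaluation provide the two natural
isomorphisms. -/
lemma IsInvertibleObject.isEquivalence {U : C} (h : IsInvertibleObject U) :
    (tensorLeft U).IsEquivalence := by
  obtain ⟨V, p, h₁, h₂⟩ := h
  let ev : V ⊗ U ≅ 𝟙_ C := @asIso _ _ _ _ _ h₁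
  let coev : 𝟙_ C ≅ U ⊗ V := @asIso _ _ _ _ _ h₂
  refine Functor.IsEquivalence.mk' (tensorLeft V)
    (NatIso.ofComponents (fun X => (λ_ X).symm ≪≫ whiskerRightIso ev.symm X ≪≫ α_ V U X) ?_)
    (NatIso.ofComponents (fun X => (α_ U V X).symm ≪≫ whiskerRightIso coev.symm X ≪≫ λ_ X) ?_)
  · intro X Y f
    have := whisker_exchange_assoc ev.inv f (α_ V U Y).hom
    simp only [id_whiskerLeft, Category.assoc, tensor_whiskerLeft, Iso.inv_hom_id,
      Category.comp_id] at this
    simp [← this]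
  · intro X Y f
    have := whisker_exchange_assoc coev.inv f (λ_ Y).hom
    simp only [tensor_whiskerLeft, Category.assoc, id_whiskerLeft, Iso.inv_hom_id,
      Category.comp_id] at this
    simp [← this]

end Invertible

/-! ### Finite invertible decompositions and exactness of `A ⊗ -` -/

namespace RepA

variable {C : Type u} [Category.{v} C] [Abelian C] [MonoidalCategory C]

/-- A finite decomposition of `A` into objects whose tensor product functors are equivalences. -/
structure InvertibleDecomposition (A : C) {I : Type u'} [Fintype I] (U : I → C) where
  /-- The inclusion of a summand. -/
  ι : ∀ i, U i ⟶ A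
  /-- The projection to a summand. -/
  π : ∀ i, A ⟶ U i
  ι_π : ∀ i, ι i ≫ π i = 𝟙 (U i)
  total : ∑ i, π i ≫ ι i = 𝟙 A
  isEquivalence : ∀ i, (tensorLeft (U i)).IsEquivalence

/-- The idempotents `π i ≫ ι i` are nonzero and orthogonal, hence linearly independent in a
finite-dimensional space, so the index set is finite. -/
lemma exists_invertibleDecomposition {k : Type w} [Field k] [Linear k C] (A : C)
    [FiniteDimensional k (A ⟶ A)] {I : Type u'} (U : I → C) (hA : Loewy.IsDirectSum A U)
    (h0 : ∀ i, ¬ IsZero (U i)) (hU : ∀ i, (tensorLeft (U i)).IsEquivalence) :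
    ∃ _ : Fintype I, Nonempty (InvertibleDecomposition A U) := by
  classical
  obtain ⟨ι, ⟨hι⟩⟩ := hA
  -- A coproduct only supplies maps out of `A`; the projections are induced by the Kronecker delta.
  let δ : ∀ i j, U j ⟶ U i := fun i j => if h : j = i then eqToHom (congrArg U h) else 0
  let π : ∀ i, A ⟶ U i := fun i => Cofan.IsColimit.desc hι (δ i)
  have hπ : ∀ i j, ι j ≫ π i = δ i j := fun i j => Cofan.IsColimit.fac hι _ _
  have hπ₁ : ∀ i, ι i ≫ π i = 𝟙 _ := fun i => by simp [hπ, δ]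
  have hπ₂ : ∀ i j, j ≠ i → ι j ≫ π i = 0 := fun i j h => by simp [hπ, δ, h]
  have hli : LinearIndependent k fun i => π i ≫ ι i := by
    rw [linearIndependent_iff']
    intro s c hc i hi
    have h1 := congrArg (fun f => ι i ≫ f) hc
    simp only [Preadditive.comp_sum, comp_zero, Linear.comp_smul] at h1
    rw [Finset.sum_eq_single i] at h1
    · rw [← Category.assoc, hπ₁, Category.id_comp] at h1
      by_contra hci
      have h2 : ι i = 0 := by
        rw [← one_smul k (ι i), ← inv_mul_cancel₀ hci, mul_smul, h1, smul_zero]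
      exact h0 i ((IsZero.iff_id_eq_zero _).2 (by rw [← hπ₁, h2, zero_comp]))
    · intro j _ hj
      rw [← Category.assoc, hπ₂ _ _ hj.symm, zero_comp, smul_zero]
    · exact fun h => absurd hi h
  have : Finite I := hli.finite
  let _ := Fintype.ofFinite I
  refine ⟨inferInstance, ⟨ι, π, hπ₁, ?_, hU⟩⟩
  refine Cofan.IsColimit.hom_ext hι _ _ fun i => ?_
  change ι i ≫ _ = ι i ≫ _
  rw [Preadditive.comp_sum, Finset.sum_eq_single i, ← Category.assoc, hπ₁, Category.id_comp,
    Category.comp_id]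
  · intro j _ hj
    rw [← Category.assoc, hπ₂ _ _ hj.symm, zero_comp]
  · simp

namespace InvertibleDecomposition

variable {A : C} {I : Type u'} [Fintype I] {U : I → C}

lemma whiskerRight_ι_π (d : InvertibleDecomposition A U) (i : I) (X : C) : d.ι i ▷ X ≫ d.π i ▷ X = 𝟙 (U i ⊗ X) := by
  rw [← comp_whiskerRight, d.ι_π, id_whiskerRight]

variable [MonoidalPreadditive C]

lemma whiskerRight_total (d : InvertibleDecomposition A U) (X : C) : ∑ i, d.π i ▷ X ≫ d.ι i ▷ X = 𝟙 (A ⊗ X) := by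
  simp only [← comp_whiskerRight, ← sum_whiskerRight, d.total, id_whiskerRight]

lemma hom_ext_left (d : InvertibleDecomposition A U) {X Z : C} {f g : Z ⟶ A ⊗ X} (h : ∀ i, f ≫ d.π i ▷ X = g ≫ d.π i ▷ X) :
    f = g := by
  rw [← Category.comp_id f, ← Category.comp_id g, ← d.whiskerRight_total]
  simp only [Preadditive.comp_sum, reassoc_of% h]

lemma hom_ext_right (d : InvertibleDecomposition A U) {X Z : C} {f g : A ⊗ X ⟶ Z} (h : ∀ i, d.ι i ▷ X ≫ f = d.ι i ▷ X ≫ g) :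
    f = g := by
  rw [← Category.id_comp f, ← Category.id_comp g, ← d.whiskerRight_total]
  simp only [Preadditive.sum_comp, Category.assoc, h]

lemma mono_whiskerLeft (d : InvertibleDecomposition A U) {X Y : C} (f : X ⟶ Y) [Mono f] : Mono (A ◁ f) := by
  refine Preadditive.mono_of_cancel_zero _ fun {Z} h hh => d.hom_ext_left fun i => ?_
  have := d.isEquivalence i
  have : Mono (U i ◁ f) := inferInstanceAs (Mono ((tensorLeft (U i)).map f))
  rw [← cancel_mono (U i ◁ f), Category.assoc, ← whisker_exchange, reassoc_of% hh]
  simp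

lemma epi_whiskerLeft (d : InvertibleDecomposition A U) {X Y : C} (f : X ⟶ Y) [Epi f] : Epi (A ◁ f) := by
  refine Preadditive.epi_of_cancel_zero _ fun {Z} h hh => d.hom_ext_right fun i => ?_
  have := d.isEquivalence i
  have : Epi (U i ◁ f) := inferInstanceAs (Epi ((tensorLeft (U i)).map f))
  rw [← cancel_epi (U i ◁ f), whisker_exchange_assoc, hh]
  simp

/-- Each component lifts because `U i ⊗ -` is exact; the finitely many lifts are summed. -/
lemma exists_lift (d : InvertibleDecomposition A U) {S : ShortComplex C} (hS : S.ShortExact)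
    {Z : C} (x : Z ⟶ A ⊗ S.X₂) (hx : x ≫ A ◁ S.g = 0) :
    ∃ l : Z ⟶ A ⊗ S.X₁, l ≫ A ◁ S.f = x := by
  have h1 : ∀ i, ∃ l : Z ⟶ U i ⊗ S.X₁, l ≫ U i ◁ S.f = x ≫ d.π i ▷ S.X₂ := by
    intro i
    have := d.isEquivalence i
    have hi : (S.map (tensorLeft (U i))).ShortExact := hS.map_of_exact _
    have := hi.mono_f
    have h0 : (x ≫ d.π i ▷ S.X₂) ≫ U i ◁ S.g = 0 := by
      rw [Category.assoc, ← whisker_exchange, reassoc_of% hx, zero_comp]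
    exact ⟨hi.exact.lift _ h0, hi.exact.lift_f _ _⟩
  choose l hl using h1
  refine ⟨∑ i, l i ≫ d.ι i ▷ S.X₁, ?_⟩
  simp only [Preadditive.sum_comp, Category.assoc, ← whisker_exchange]
  simp only [reassoc_of% hl, ← Preadditive.comp_sum, d.whiskerRight_total, Category.comp_id]

lemma shortExact_whiskerLeft (d : InvertibleDecomposition A U) {S : ShortComplex C}
    (hS : S.ShortExact) : (S.map (tensorLeft A)).ShortExact := by
  have := hS.mono_f
  have := hS.epi_g
  have : Mono (S.map (tensorLeft A)).f := d.mono_whiskerLeft S.f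
  have : Epi (S.map (tensorLeft A)).g := d.epi_whiskerLeft S.g
  refine .mk ?_
  rw [ShortComplex.exact_iff_exact_up_to_refinements]
  intro Z x hx
  obtain ⟨l, hl⟩ := d.exists_lift hS x hx
  exact ⟨Z, 𝟙 Z, inferInstance, l, (Category.id_comp x).trans hl.symm⟩

lemma exact_tensorLeft (d : InvertibleDecomposition A U) :
    PreservesFiniteLimits (tensorLeft A) ∧ PreservesFiniteColimits (tensorLeft A) :=
  ((Functor.exact_tfae (tensorLeft A)).out 0 3).1 fun _ hS => d.shortExact_whiskerLeft hS

end InvertibleDecomposition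

end RepA

/-! ### Right tensoring of induced modules, and faithfulness of induction -/

namespace RepA

open scoped MonObj

section TensorRight

variable {C : Type u} [Category.{v} C] [MonoidalCategory C] {A : C} [MonObj A]

/-- Tensoring a morphism of induced modules on the right with an object. -/
def tensorRightHom {X X' : C} (φ : (induction A).obj X ⟶ (induction A).obj X') (Y : C) :
    (induction A).obj (X ⊗ Y) ⟶ (induction A).obj (X' ⊗ Y) :=
  homMk (show A ⊗ X ⊗ Y ⟶ A ⊗ X' ⊗ Y from
    (α_ A X Y).inv ≫ (show A ⊗ X ⟶ A ⊗ X' from φ.hom) ▷ Y ≫ (α_ A X' Y).hom) (by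
    have h : ((α_ A A X).inv ≫ μ[A] ▷ X) ≫ (show A ⊗ X ⟶ A ⊗ X' from φ.hom) =
      A ◁ (show A ⊗ X ⟶ A ⊗ X' from φ.hom) ≫ (α_ A A X').inv ≫ μ[A] ▷ X' := act_hom φ
    generalize (show A ⊗ X ⟶ A ⊗ X' from φ.hom) = f at h ⊢
    change ((α_ A A (X ⊗ Y)).inv ≫ μ[A] ▷ (X ⊗ Y)) ≫ (α_ A X Y).inv ≫ f ▷ Y ≫ (α_ A X' Y).hom =
      A ◁ ((α_ A X Y).inv ≫ f ▷ Y ≫ (α_ A X' Y).hom) ≫ (α_ A A (X' ⊗ Y)).inv ≫ μ[A] ▷ (X' ⊗ Y)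
    have h' := congrArg (fun t => t ▷ Y) h
    simp only [comp_whiskerRight, Category.assoc] at h'
    have e1 : (α_ A A (X ⊗ Y)).inv ≫ μ[A] ▷ (X ⊗ Y) ≫ (α_ A X Y).inv =
        A ◁ (α_ A X Y).inv ≫ (α_ A (A ⊗ X) Y).inv ≫ (α_ A A X).inv ▷ Y ≫ μ[A] ▷ X ▷ Y := by
      simp
    have e2 : A ◁ (α_ A X' Y).hom ≫ (α_ A A (X' ⊗ Y)).inv ≫ μ[A] ▷ (X' ⊗ Y) =
        (α_ A (A ⊗ X') Y).inv ≫ (α_ A A X').inv ▷ Y ≫ μ[A] ▷ X' ▷ Y ≫ (α_ A X' Y).hom := by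
      simp
    simp only [Category.assoc, whiskerLeft_comp]
    rw [reassoc_of% e1, e2, reassoc_of% h']
    simp)

lemma isIso_tensorRightHom {X X' : C} (φ : (induction A).obj X ⟶ (induction A).obj X') [IsIso φ]
    (Y : C) : IsIso (tensorRightHom φ Y) := by
  have : IsIso (show A ⊗ X ⟶ A ⊗ X' from φ.hom) := inferInstanceAs (IsIso ((Mod.forget A).map φ))
  have h : IsIso ((α_ A X Y).inv ≫ (show A ⊗ X ⟶ A ⊗ X' from φ.hom) ▷ Y ≫ (α_ A X' Y).hom) :=
    inferInstance
  have : IsIso (tensorRightHom φ Y).hom := h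
  exact isIso_of_isIso_hom _

/-- The induced module of the unit is the regular module. -/
noncomputable def inductionUnitIso : (induction A).obj (𝟙_ C) ≅ Mod.regular A :=
  have : IsIso (homMk (M := (induction A).obj (𝟙_ C)) (N := Mod.regular A)
      (show A ⊗ 𝟙_ C ⟶ A from (ρ_ A).hom) (by
        change ((α_ A A (𝟙_ C)).inv ≫ μ[A] ▷ 𝟙_ C) ≫ (ρ_ A).hom = A ◁ (ρ_ A).hom ≫ μ[A]
        simp)) := by
    have : IsIso (ρ_ A).hom := inferInstance
    exact @isIso_of_isIso_hom _ _ _ _ _ _ _ _ this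
  @asIso _ _ _ _ _ this

end TensorRight

variable {C : Type u} [Category.{v} C] [Abelian C] [MonoidalCategory C]
  {A : C} [MonObj A] {I : Type u'} [Fintype I] {U : I → C}

/-- `A ◁ f` determines its direct summand `U i ◁ f`, which determines `f`; an index exists because
`A` is nonzero. -/
lemma InvertibleDecomposition.faithful_induction (d : InvertibleDecomposition A U) (hA : ¬ IsZero A) :
    (induction A).Faithful where
  map_injective {X Y f g} h := by
    have h' : A ◁ f = A ◁ g := congrArg Mod.Hom.hom h
    obtain ⟨i⟩ : Nonempty I := by
      by_contra hI
      rw [not_nonempty_iff] at hI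
      exact hA ((IsZero.iff_id_eq_zero A).2 (by rw [← d.total]; simp))
    have := d.isEquivalence i
    apply (tensorLeft (U i)).map_injective
    change U i ◁ f = U i ◁ g
    rw [← Category.id_comp (U i ◁ f), ← Category.id_comp (U i ◁ g), ← d.whiskerRight_ι_π,
      Category.assoc, Category.assoc, ← whisker_exchange, ← whisker_exchange, h']

variable [MonoidalPreadditive C]

lemma ext_ne_zero {X : C} {M : Mod C A} {g : X ⟶ M.X} (hg : g ≠ 0) : ext (M := M) g ≠ 0 := by
  intro h
  apply hg
  rw [← restr_ext (M := M) g, h]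
  change (λ_ X).inv ≫ η[A] ▷ X ≫ (0 : A ⊗ X ⟶ M.X) = 0
  rw [comp_zero, comp_zero]

lemma not_isZero_of_simple_regular (hA : Simple (Mod.regular A)) : ¬ IsZero A := fun h =>
  Simple.not_isZero (Mod.regular A)
    ((IsZero.iff_id_eq_zero _).2 (Mod.hom_ext _ _ (h.eq_of_src _ _)))

lemma one_ne_zero_of_simple_regular (hA : Simple (Mod.regular A)) : η[A] ≠ 0 := by
  intro h
  refine not_isZero_of_simple_regular hA ((IsZero.iff_id_eq_zero A).2 ?_)
  rw [← cancel_epi (λ_ A).hom, Category.comp_id, ← MonObj.one_mul A, h]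
  simp

variable [PreservesFiniteColimits (tensorLeft A)]

attribute [local instance] modAbelian

/-- The braiding trades right for left tensoring with `Y`, which is an equivalence and preserves
epimorphisms. -/
lemma epi_tensorRightHom [BraidedCategory C] {X X' : C}
    (φ : (induction A).obj X ⟶ (induction A).obj X') [Epi φ] (Y : C)
    [(tensorLeft Y).IsEquivalence] : Epi (tensorRightHom φ Y) := by
  have h1 : Epi (show A ⊗ X ⟶ A ⊗ X' from φ.hom) := epi_hom_of_epi φ
  have h2 : Epi ((show A ⊗ X ⟶ A ⊗ X' from φ.hom) ▷ Y) := by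
    generalize (show A ⊗ X ⟶ A ⊗ X' from φ.hom) = f at h1 ⊢
    have : Epi (Y ◁ f) := inferInstanceAs (Epi ((tensorLeft Y).map f))
    have h : f ▷ Y = (β_ (A ⊗ X) Y).hom ≫ Y ◁ f ≫ (β_ (A ⊗ X') Y).inv := by
      rw [← BraidedCategory.braiding_naturality_left_assoc]
      simp
    rw [h]
    infer_instance
  have h3 : Epi ((α_ A X Y).inv ≫ (show A ⊗ X ⟶ A ⊗ X' from φ.hom) ▷ Y ≫ (α_ A X' Y).hom) :=
    inferInstance
  have : Epi (tensorRightHom φ Y).hom := h3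
  exact (Mod.forget A).epi_of_epi_map this

variable [PreservesFiniteLimits (tensorLeft A)]

/-! ### Consequences of the absence of fixed points -/

namespace InvertibleDecomposition

/-- Simplicity descends from the regular module `F (𝟙_ C)`, since induction is exact, faithful and
therefore conservative. -/
lemma simple_unit (d : InvertibleDecomposition A U) (hA : Simple (Mod.regular A)) :
    Simple (𝟙_ C) := by
  have := d.faithful_induction (not_isZero_of_simple_regular hA)
  have : Simple ((induction A).obj (𝟙_ C)) := Simple.of_iso inductionUnitIso
  have : (induction A).ReflectsIsomorphisms :=
    reflectsIsomorphisms_of_reflectsMonomorphisms_of_reflectsEpimorphisms _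
  exact (induction A).simple_of_simple_obj (𝟙_ C)

omit [MonoidalPreadditive C] [MonObj A] [PreservesFiniteLimits (tensorLeft A)]
  [PreservesFiniteColimits (tensorLeft A)] in
lemma simple_tensor (d : InvertibleDecomposition A U) (i : I) (S : C) [Simple S] :
    Simple (U i ⊗ S) :=
  have := d.isEquivalence i
  simple_obj (tensorLeft (U i)) S

lemma simple_summand (d : InvertibleDecomposition A U) (hA : Simple (Mod.regular A)) (i : I) :
    Simple (U i) :=
  have := d.simple_unit hA
  have := d.simple_tensor i (𝟙_ C)
  Simple.of_iso (ρ_ (U i)).symm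

/-- The nonzero unit of `A` has a nonzero component, which is invertible as a map between simple
objects. -/
lemma exists_unit_index (d : InvertibleDecomposition A U) (hA : Simple (Mod.regular A))
    (hfix : NoFixedPoints U) :
    ∃ i₀, IsIso (η[A] ≫ d.π i₀) ∧ ∀ i ≠ i₀, IsEmpty (U i ≅ 𝟙_ C) := by
  have := d.simple_unit hA
  have := fun i => d.simple_summand hA i
  obtain ⟨i₀, h₀⟩ : ∃ i, η[A] ≫ d.π i ≠ 0 := by
    by_contra! h
    refine one_ne_zero_of_simple_regular hA ?_
    rw [← Category.comp_id η[A], ← d.total, Preadditive.comp_sum]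
    exact Finset.sum_eq_zero fun i _ => by rw [← Category.assoc, h, zero_comp]
  have hi₀ : IsIso (η[A] ≫ d.π i₀) := isIso_of_hom_simple h₀
  exact ⟨i₀, hi₀, fun i hi => ⟨fun e =>
    hi (hfix.unit_unique i i₀ ⟨e⟩ ⟨(asIso (η[A] ≫ d.π i₀)).symm⟩)⟩⟩

lemma exists_retraction (d : InvertibleDecomposition A U) (hA : Simple (Mod.regular A))
    (hfix : NoFixedPoints U) : ∃ r : A ⟶ 𝟙_ C, η[A] ≫ r = 𝟙 _ := by
  obtain ⟨i₀, _, -⟩ := d.exists_unit_index hA hfix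
  exact ⟨d.π i₀ ≫ inv (η[A] ≫ d.π i₀), by rw [← Category.assoc, IsIso.hom_inv_id]⟩

/-- A morphism from a simple object to its induced module factors through the unit. -/
lemma exists_comp_unit_eq (d : InvertibleDecomposition A U) (hA : Simple (Mod.regular A))
    (hfix : NoFixedPoints U) {S : C} [Simple S] (g : S ⟶ A ⊗ S) :
    ∃ c : S ⟶ S, c ≫ (λ_ S).inv ≫ η[A] ▷ S = g := by
  obtain ⟨i₀, h₀, hne⟩ := d.exists_unit_index hA hfix
  have := d.simple_unit hA
  have := fun i => d.simple_summand hA i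
  have := fun i => d.simple_tensor i S
  refine ⟨g ≫ d.π i₀ ▷ S ≫ inv (η[A] ≫ d.π i₀) ▷ S ≫ (λ_ S).hom, d.hom_ext_left fun i => ?_⟩
  by_cases hi : i = i₀
  · subst hi
    simp only [Category.assoc, Iso.hom_inv_id_assoc]
    rw [← comp_whiskerRight, ← comp_whiskerRight, IsIso.inv_hom_id]
    simp
  -- A nonzero component would be an isomorphism `S ≅ U i ⊗ S`, a fixed point.
  · have h1 : g ≫ d.π i ▷ S = 0 := by
      by_contra h
      have := isIso_of_hom_simple h
      obtain ⟨e⟩ := hfix.unit_of_fixes i S inferInstance ⟨(asIso (g ≫ d.π i ▷ S)).symm⟩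
      exact (hne i hi).false e
    have h2 : η[A] ≫ d.π i = 0 := by
      by_contra h
      have := isIso_of_hom_simple h
      exact (hne i hi).false (asIso (η[A] ≫ d.π i)).symm
    simp only [Category.assoc]
    rw [h1, ← comp_whiskerRight, h2]
    simp

/-- By adjunction `f` corresponds to a map `S ⟶ A ⊗ S`, which factors through the unit; so `f` is
induced from an endomorphism `c` of `S`, and Schur's lemma applies to `c`. -/
lemma isIso_of_ne_zero (d : InvertibleDecomposition A U) (hA : Simple (Mod.regular A))
    (hfix : NoFixedPoints U) {S : C} [Simple S]
    (f : (induction A).obj S ⟶ (induction A).obj S) (hf : f ≠ 0) : IsIso f := by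
  obtain ⟨c, hc⟩ := d.exists_comp_unit_eq hA hfix (restr (show A ⊗ S ⟶ A ⊗ S from f.hom))
  have hfc : f = (induction A).map c := by
    have h1 : restr (show A ⊗ S ⟶ A ⊗ S from A ◁ c) = c ≫ (λ_ S).inv ≫ η[A] ▷ S := by
      simp only [restr]
      rw [← whisker_exchange]
      simp
    rw [← ext_restr f, ← ext_restr ((induction A).map c)]
    exact congrArg (ext (M := (induction A).obj S)) (hc.symm.trans h1.symm)
  have hc0 : c ≠ 0 := by
    rintro rfl
    exact hf (by rw [hfc, Functor.map_zero])
  have := isIso_of_hom_simple hc0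
  rw [hfc]
  infer_instance

/-- Some `U j` in the family is inverse to `U i`. Tensoring the surjection `F (U j) ⟶ F (𝟙_ C)` with
`U i` gives a surjection `F (𝟙_ C) ⟶ F (U i)`, nonzero with simple source. -/
lemma nonempty_induction_summand_iso [BraidedCategory C] (d : InvertibleDecomposition A U)
    (hA : Simple (Mod.regular A)) (hfix : NoFixedPoints U) (i : I) :
    Nonempty ((induction A).obj (𝟙_ C) ≅ (induction A).obj (U i)) := by
  have := d.faithful_induction (not_isZero_of_simple_regular hA)
  have := d.simple_unit hA
  have := fun i => d.simple_summand hA i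
  have := fun i S [Simple S] => d.simple_tensor i S
  have := fun i => d.isEquivalence i
  have : Simple ((induction A).obj (𝟙_ C)) := Simple.of_iso inductionUnitIso
  have hepi : ∀ i, Epi (ext (M := Mod.regular A) (d.ι i)) := fun i => by
    refine epi_of_nonzero_to_simple (ext_ne_zero fun h => Simple.not_isZero (U i) ?_)
    have h' : d.ι i = 0 := h
    rw [IsZero.iff_id_eq_zero, ← d.ι_π, h', zero_comp]
  obtain ⟨i₀, h₀, -⟩ := d.exists_unit_index hA hfix
  -- Multiplication `A ⊗ U i ⟶ A` is onto, so some `U j ⊗ U i` maps nontrivially to the summand `U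
  -- i₀ ≅ 𝟙_ C`; both are simple.
  obtain ⟨j, ⟨e⟩⟩ : ∃ j, Nonempty (U j ⊗ U i ≅ 𝟙_ C) := by
    let f : A ⊗ U i ⟶ A := (ext (M := Mod.regular A) (d.ι i)).hom
    have hf : Epi f := epi_hom_of_epi (ext (M := Mod.regular A) (d.ι i))
    have hπ : Epi (d.π i₀) := (SplitEpi.mk _ (d.ι_π i₀)).epi
    have hne : f ≫ d.π i₀ ≠ 0 := by
      intro h
      refine Simple.not_isZero (U i₀) ((IsZero.iff_id_eq_zero _).2 ?_)
      rw [← cancel_epi (f ≫ d.π i₀), h, zero_comp, zero_comp]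
    obtain ⟨j, hj⟩ : ∃ j, d.ι j ▷ U i ≫ f ≫ d.π i₀ ≠ 0 := by
      by_contra! h
      exact hne (d.hom_ext_right fun j => by rw [h, comp_zero])
    have := isIso_of_hom_simple hj
    exact ⟨j, ⟨asIso (d.ι j ▷ U i ≫ f ≫ d.π i₀) ≪≫ (asIso (η[A] ≫ d.π i₀)).symm⟩⟩
  have := hepi j
  let φ : (induction A).obj (U j) ⟶ (induction A).obj (𝟙_ C) :=
    ext (M := Mod.regular A) (d.ι j) ≫ inductionUnitIso.inv
  have hφ : Epi φ := inferInstance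
  have := epi_tensorRightHom φ (U i)
  let ψ : (induction A).obj (𝟙_ C) ⟶ (induction A).obj (U i) :=
    (induction A).map e.inv ≫ tensorRightHom φ (U i) ≫ (induction A).map (λ_ (U i)).hom
  have hψ : Epi ψ := inferInstance
  have hψ0 : ψ ≠ 0 := by
    intro h
    refine Simple.not_isZero (U i) ((IsZero.iff_id_eq_zero _).2 ((induction A).map_injective ?_))
    rw [← cancel_epi ψ, h, zero_comp, zero_comp]
  have := isIso_of_epi_of_nonzero hψ0
  exact ⟨asIso ψ⟩

lemma nonempty_induction_tensor_iso [BraidedCategory C] (d : InvertibleDecomposition A U)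
    (hA : Simple (Mod.regular A)) (hfix : NoFixedPoints U) (i : I) (Y : C) :
    Nonempty ((induction A).obj Y ≅ (induction A).obj (U i ⊗ Y)) := by
  obtain ⟨e⟩ := d.nonempty_induction_summand_iso hA hfix i
  have := isIso_tensorRightHom e.hom Y
  exact ⟨(induction A).mapIso (λ_ Y).symm ≪≫ asIso (tensorRightHom e.hom Y)⟩

/-- Induction preserves simple objects. -/
lemma simple_induction_obj [BraidedCategory C] (hC : ∀ X : C, IsArtinianObject X)
    (d : InvertibleDecomposition A U) (hA : Simple (Mod.regular A)) (hfix : NoFixedPoints U)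
    (S : C) [Simple S] : Simple ((induction A).obj S) := by
  have := d.faithful_induction (not_isZero_of_simple_regular hA)
  have := fun i S [Simple S] => d.simple_tensor i S
  refine ⟨fun {N} m _ => ⟨?_, fun hm => ?_⟩⟩
  · rintro _ rfl
    refine Simple.not_isZero S ((IsZero.iff_id_eq_zero _).2 ((induction A).map_injective ?_))
    rw [← cancel_epi (0 : N ⟶ (induction A).obj S)]
    simp
  · have hN : ¬ IsZero N.X := fun h => hm (Mod.hom_ext _ _ (h.eq_of_src _ _))
    have := hC N.X
    obtain ⟨T, hT⟩ := exists_simple_subobject hN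
    have hmono : Mono (show N.X ⟶ A ⊗ S from m.hom) := mono_hom_of_mono m
    have hT0 : T.arrow ≠ 0 := fun h => Simple.not_isZero (T : C)
      ((IsZero.iff_id_eq_zero _).2 (by rw [← cancel_mono T.arrow, h, comp_zero, comp_zero]))
    -- `T` is simple in `C`, so a nonzero component identifies it with `U i ⊗ S`, whose induced
    -- module is isomorphic to that of `S`.
    obtain ⟨i, hi⟩ : ∃ i, T.arrow ≫ (show N.X ⟶ A ⊗ S from m.hom) ≫ d.π i ▷ S ≠ 0 := by
      by_contra! h
      apply hT0
      rw [← cancel_mono (show N.X ⟶ A ⊗ S from m.hom), zero_comp]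
      exact d.hom_ext_left fun i => by rw [Category.assoc, h, zero_comp]
    have := isIso_of_hom_simple hi
    obtain ⟨e⟩ := d.nonempty_induction_tensor_iso hA hfix i S
    let q : (induction A).obj S ⟶ N := e.hom ≫ (induction A).map
      (inv (T.arrow ≫ (show N.X ⟶ A ⊗ S from m.hom) ≫ d.π i ▷ S)) ≫ ext (M := N) T.arrow
    have hq : q ≠ 0 := by
      intro h
      apply ext_ne_zero (M := N) hT0
      simpa [q] using h
    have hqm : q ≫ m ≠ 0 := fun h => hq (by rw [← cancel_mono m, h, zero_comp])
    have := d.isIso_of_ne_zero hA hfix _ hqm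
    have : Epi m := epi_of_epi q m
    exact isIso_of_mono_of_epi m

/-- Take a simple subobject `S` of `T` in `C`; the adjoint map from the induced module is nonzero
between simple modules. -/
lemma exists_induction_iso [BraidedCategory C] (hC : ∀ X : C, IsArtinianObject X)
    (d : InvertibleDecomposition A U) (hA : Simple (Mod.regular A)) (hfix : NoFixedPoints U)
    (T : Mod C A) [Simple T] : ∃ S : C, Simple S ∧ Nonempty ((induction A).obj S ≅ T) := by
  have hT : ¬ IsZero T.X := fun h => Simple.not_isZero T
    ((IsZero.iff_id_eq_zero _).2 (Mod.hom_ext _ _ (h.eq_of_src _ _)))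
  have := hC T.X
  obtain ⟨S, hS⟩ := exists_simple_subobject hT
  have hS0 : S.arrow ≠ 0 := fun h => Simple.not_isZero (S : C)
    ((IsZero.iff_id_eq_zero _).2 (by rw [← cancel_mono S.arrow, h, comp_zero, comp_zero]))
  have := d.simple_induction_obj hC hA hfix (S : C)
  have := isIso_of_hom_simple (ext_ne_zero (M := T) hS0)
  exact ⟨S, hS, ⟨asIso (ext (M := T) S.arrow)⟩⟩

omit [MonObj A] [PreservesFiniteLimits (tensorLeft A)]
  [PreservesFiniteColimits (tensorLeft A)] in
lemma isSemisimple_tensor (d : InvertibleDecomposition A U) (S : C) [Simple S] :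
    Loewy.IsSemisimple (A ⊗ S) :=
  .of_jointly_epi (fun i => U i ⊗ S) (fun i => d.ι i ▷ S)
    (fun i => haveI := d.simple_tensor i S; .of_simple _)
    fun h hh => d.hom_ext_right fun i => by rw [hh, comp_zero]

/-- A semisimple module is semisimple as an object of the ambient category. -/
lemma isSemisimple_forget [BraidedCategory C] (hC : ∀ X : C, IsArtinianObject X)
    (d : InvertibleDecomposition A U) (hA : Simple (Mod.regular A)) (hfix : NoFixedPoints U)
    {M : Mod C A} (hM : Loewy.IsSemisimple M) : Loewy.IsSemisimple M.X :=
  hM.map (Mod.forget A) fun T _ => by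
    obtain ⟨S, _, ⟨e⟩⟩ := d.exists_induction_iso hC hA hfix T
    exact (d.isSemisimple_tensor S).of_iso ((Mod.forget A).mapIso e)

lemma isSemisimple_induction_obj [BraidedCategory C] (hC : ∀ X : C, IsArtinianObject X)
    (d : InvertibleDecomposition A U) (hA : Simple (Mod.regular A)) (hfix : NoFixedPoints U)
    {X : C} (hX : Loewy.IsSemisimple X) : Loewy.IsSemisimple ((induction A).obj X) :=
  hX.map (induction A) fun S _ =>
    haveI := d.simple_induction_obj hC hA hfix S
    .of_simple _

/-- By exactness, a map `f` from a semisimple module factors through the image of `P` once it dies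
in `F (X / P)`. This is checked in `C`, where the source is still semisimple, one component `U i ⊗
-` at a time. -/
lemma isSocle_mapSubobject [BraidedCategory C] (hC : ∀ X : C, IsArtinianObject X)
    (d : InvertibleDecomposition A U) (hA : Simple (Mod.regular A)) (hfix : NoFixedPoints U)
    {X : C} {P : Subobject X} (hP : Loewy.IsSocle P) :
    Loewy.IsSocle (Loewy.mapSubobject (induction A) P) := by
  have hS : (ShortComplex.mk P.arrow (cokernel.π P.arrow) (cokernel.condition _)).ShortExact :=
    .mk (ShortComplex.exact_cokernel _)
  have hFS := hS.map_of_exact (induction A)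
  have := hFS.mono_f
  refine Loewy.isSocle_of_factors ((d.isSemisimple_induction_obj hC hA hfix hP.1).of_iso
    (Loewy.mapSubobjectIso (induction A) P)) fun Q f hQ => ?_
  have h0 : f ≫ (induction A).map (cokernel.π P.arrow) = 0 := by
    apply Mod.hom_ext
    change (show Q.X ⟶ A ⊗ X from f.hom) ≫ A ◁ cokernel.π P.arrow = 0
    refine d.hom_ext_left fun i => ?_
    have := d.isEquivalence i
    rw [Category.assoc, whisker_exchange, zero_comp, ← Category.assoc]
    refine Loewy.comp_map_eq_zero_of_isSemisimple (tensorLeft (U i)) (cokernel.π P.arrow)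
      (fun V g hV => ?_) (d.isSemisimple_forget hC hA hfix hQ) _
    obtain ⟨l, rfl⟩ := hP.factors hV g
    rw [Category.assoc, cokernel.condition, comp_zero]
  obtain ⟨l, hl⟩ : ∃ l : Q ⟶ (induction A).obj (P : C), l ≫ (induction A).map P.arrow = f :=
    ⟨hFS.exact.lift f h0, hFS.exact.lift_f f h0⟩
  exact ⟨l ≫ (Loewy.mapSubobjectIso (induction A) P).hom, by simp [hl]⟩

lemma isRadical_mapSubobject [BraidedCategory C] (hC : ∀ X : C, IsArtinianObject X)
    (d : InvertibleDecomposition A U) (hA : Simple (Mod.regular A)) (hfix : NoFixedPoints U)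
    {X : C} {P : Subobject X} (hP : Loewy.IsRadical P) :
    Loewy.IsRadical (Loewy.mapSubobject (induction A) P) := by
  obtain ⟨Z, hPZ, hZ⟩ := hP.1
  refine Loewy.isRadical_of_comp_eq_zero (d.isSemisimple_induction_obj hC hA hfix hZ)
    ((hPZ.map (induction A)).comp_eq (Loewy.mapSubobjectIso (induction A) P).symm (by simp))
    fun W g hW => ?_
  suffices h : (induction A).map P.arrow ≫ g = 0 by
    rw [← Loewy.mapSubobjectIso_inv_map, Category.assoc, h, comp_zero]
  apply Mod.hom_ext
  change A ◁ P.arrow ≫ (show A ⊗ X ⟶ W.X from g.hom) = 0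
  refine d.hom_ext_right fun i => ?_
  have := d.isEquivalence i
  rw [← whisker_exchange_assoc, comp_zero]
  exact Loewy.map_comp_eq_zero_of_isSemisimple (tensorLeft (U i)) P.arrow
    (fun V f hV => hP.comp_eq_zero hV f) (d.isSemisimple_forget hC hA hfix hW) _

/-- A section `s` of `F g` gives the section `Y ⟶ A ⊗ Y ⟶ A ⊗ E ⟶ E` of `g`, using the unit, `s` and
the retraction `r` of the unit. -/
lemma hasNonsplitSequence_induction (d : InvertibleDecomposition A U)
    (hA : Simple (Mod.regular A)) (hfix : NoFixedPoints U) {Y' E Y : C}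
    (h : Loewy.HasNonsplitSequence Y' E Y) :
    Loewy.HasNonsplitSequence ((induction A).obj Y') ((induction A).obj E)
      ((induction A).obj Y) := by
  obtain ⟨f, g, w, hS, hns⟩ := h
  obtain ⟨r, hr⟩ := d.exists_retraction hA hfix
  refine ⟨(induction A).map f, (induction A).map g, by rw [← Functor.map_comp, w, Functor.map_zero],
    hS.map_of_exact (induction A), ⟨fun σ => hns.false ?_⟩⟩
  have hs : (show A ⊗ Y ⟶ A ⊗ E from σ.s.hom) ≫ A ◁ g = 𝟙 (A ⊗ Y) :=
    congrArg Mod.Hom.hom σ.s_g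
  generalize (show A ⊗ Y ⟶ A ⊗ E from σ.s.hom) = s at hs
  refine ShortComplex.Splitting.ofExactOfSection _ hS.exact
    ((λ_ Y).inv ≫ η[A] ▷ Y ≫ s ≫ r ▷ E ≫ (λ_ E).hom) ?_ hS.mono_f
  change ((λ_ Y).inv ≫ η[A] ▷ Y ≫ s ≫ r ▷ E ≫ (λ_ E).hom) ≫ g = 𝟙 Y
  simp only [Category.assoc]
  rw [← leftUnitor_naturality, ← whisker_exchange_assoc, reassoc_of% hs,
    ← comp_whiskerRight_assoc, hr]
  simp

end InvertibleDecomposition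

end RepA

theorem theorem3p4 {k : Type w} [Field k] {C : Type u} [Category.{v} C] [Abelian C] [Linear k C]
    [MonoidalCategory C] [MonoidalPreadditive C] [MonoidalLinear k C] [BraidedCategory C]
    [IsLocallyFinite k C]
    (A : C) [MonObj A] [IsCommMonObj A]
    {I : Type u'} (U : I → C) (hU : ∀ i, IsInvertibleObject (U i))
    (hA : Loewy.IsDirectSum A U)
    (hsimple : Simple (Mod.regular A))
    (hfix : NoFixedPoints U)
    (hunit : ∃ B : C, Nonempty (A ≅ 𝟙_ C ⊞ B)) :
    Loewy.PreservesSocleFiltrations (RepA.induction A) ∧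
    Loewy.PreservesRadicalFiltrations (RepA.induction A) ∧
    Loewy.PreservesSocleDiagrams (RepA.induction A) ∧
    Loewy.PreservesRadicalDiagrams (RepA.induction A) := by
  have hArt : ∀ X : C, IsArtinianObject X := IsLocallyFinite.artinian k
  have hNoe : ∀ X : C, IsNoetherianObject X := IsLocallyFinite.noetherian k
  have : FiniteDimensional k (A ⟶ A) := IsLocallyFinite.finite_hom A A
  have hE := fun i => (hU i).isEquivalence
  have hA0 := RepA.not_isZero_of_simple_regular hsimple
  -- Tensoring with a zero object is the zero functor; were it also faithful, `A` would be zero.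
  have hU0 : ∀ i, ¬ IsZero (U i) := by
    intro i hi
    have := hE i
    refine hA0 ((IsZero.iff_id_eq_zero A).2 ((tensorLeft (U i)).map_injective ?_))
    exact (((tensorRight A).map_isZero hi).eq_of_src _ _)
  obtain ⟨_, ⟨d⟩⟩ := RepA.exists_invertibleDecomposition (k := k) A U hA hU0 hE
  obtain ⟨_, _⟩ := d.exact_tensorLeft
  -- This abelian structure extends the preadditive structure used in the statement.
  let _ := RepA.modAbelian A
  have := d.faithful_induction hA0
  have hsoc := fun (X : C) (P : Subobject X) (hP : Loewy.IsSocle P) =>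
    d.isSocle_mapSubobject hArt hsimple hfix hP
  have hrad := fun (X : C) (P : Subobject X) (hP : Loewy.IsRadical P) =>
    d.isRadical_mapSubobject hArt hsimple hfix hP
  have hS := fun (S : C) (_ : Simple S) => d.simple_induction_obj hArt hsimple hfix S
  have hns := fun Y' E Y (h : Loewy.HasNonsplitSequence Y' E Y) =>
    d.hasNonsplitSequence_induction hsimple hfix h
  exact ⟨Loewy.preservesSocleFiltrations _ hArt hNoe hsoc,
    Loewy.preservesRadicalFiltrations _ hArt hNoe hrad,
    Loewy.preservesSocleDiagrams _ hsoc hS hns, Loewy.preservesRadicalDiagrams _ hrad hS hns⟩
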